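/- Let $X=(X_t)_{t\ge 0}$ be a spectrally negative Lévy process: $X_0=0$ a.s., $X$ has càdlàg paths and stationary independent increments, and $$E(e^{i\theta X_t})=e^{-t\Psi(\theta)},\qquad \Psi(\theta)=i\mu\theta+\frac{\sigma^2}{2}\theta^2+\int_{\mathbb R}\bigl(1-e^{i\theta x}+i\theta x\mathbf 1_{\{|x|<1\}}\bigr)\Pi(dx),\qquad t\ge 0,\ \theta\in\mathbb R,$$ where $\mu,\sigma\in\mathbb R$ and $\Pi$ is a measure on $\mathbb R\setminus\{0\}$ with $\int(1\wedge x^2)\,\Pi(dx)<\infty$ and $\Pi(0,\infty)=0$; the case where the paths of $X$ are a.s. monotone is excluded. Let $\psi(\beta)=\log E(e^{\beta X_1})$, $\beta\ge 0$, be its Laplace exponent and, for $q\ge 0$, let $\Phi(q)=\sup\{\lambda\ge 0:\psi(\lambda)=q\}$. The $q$-scale function $W^{(q)}:\mathbb R\to[0,\infty)$ is the function that vanishes on $(-\infty,0)$, is right continuous on $[0,\infty)$, and satisfies $\int_0^\infty e^{-\beta x}W^{(q)}(x)\,dx=1/(\psi(\beta)-q)$ for all $\beta>\Phi(q)$. Say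 that $X$ has bounded variation if a.s. its paths have bounded variation on every compact time interval, and unbounded variation otherwise. Then for every $q\ge 0$: 1. $W^{(q)}(0)=0$ if and only if $X$ has unbounded variation, and $X$ has unbounded variation if and only if $\sigma\neq 0$ or $\int_{(-1,0)}|x|\,\Pi(dx)=\infty$. 2. If $X$ has bounded variation, there is a unique $\delta\in\mathbb R$ such that a.s. $X_t=\delta t-S_t$ for all $t\ge 0$ with $S$ a pure jump subordinator (a Lévy process which a.s. has nondecreasing paths and equals at every time the sum of its jumps so far); moreover $\delta>0$ and $W^{(q)}(0)=1/\delta$. 3. $W^{(q)}(0)=\lim_{\beta\to\infty}\beta/\psi(\beta)$. -/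

import Mathlib

open MeasureTheory ProbabilityTheory Filter Topology
open scoped NNReal ENNReal

noncomputable section

/-- `f` is càdlàg: right continuous with (finite) left limits at every time. -/
def IsCadlagPath (f : ℝ≥0 → ℝ) : Prop :=
  ∀ t : ℝ≥0, ContinuousWithinAt f (Set.Ici t) t ∧ ∃ l : ℝ, Tendsto f (𝓝[<] t) (𝓝 l)

/-- A real Lévy process: it starts at `0`, has almost surely càdlàg paths, and has stationary
independent increments. -/
structure IsLevyProcess {Ω : Type*} [MeasurableSpace Ω] (X : ℝ≥0 → Ω → ℝ) (P : Measure Ω) :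
    Prop where
  measurable : ∀ t, Measurable (X t)
  start_zero : ∀ᵐ ω ∂P, X 0 ω = 0
  cadlag : ∀ᵐ ω ∂P, IsCadlagPath (fun t => X t ω)
  indep_increments : HasIndepIncrements X P
  stationary : ∀ s h : ℝ≥0, IdentDistrib (fun ω => X (s + h) ω - X s ω) (X h) P P

/-- `ν` is a Lévy measure: it lives on `ℝ \ {0}` and `∫ (1 ∧ x²) ν(dx) < ∞`. -/
def IsLevyMeasure (ν : Measure ℝ) : Prop :=
  ν {0} = 0 ∧ ∫⁻ x, ENNReal.ofReal (min 1 (x ^ 2)) ∂ν < ⊤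

/-- The characteristic exponent
`Ψ(θ) = iμθ + σ²θ²/2 + ∫ (1 - exp (iθx) + iθx 1_{|x| < 1}) ν(dx)`. -/
def charExponent (μ σ : ℝ) (ν : Measure ℝ) (θ : ℝ) : ℂ :=
  Complex.I * μ * θ + (σ : ℂ) ^ 2 / 2 * (θ : ℂ) ^ 2 +
    ∫ x : ℝ, (1 - Complex.exp (Complex.I * θ * x) +
      Set.indicator {y : ℝ | |y| < 1} (fun y : ℝ => Complex.I * θ * y) x) ∂ν

/-- `X` has Lévy–Khintchine characteristics `(μ, σ, ν)`: `ν` is a Lévy measure and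
`E[exp (iθ X_t)] = exp (-t Ψ(θ))` for all `t ≥ 0` and real `θ`. -/
def HasCharacteristics {Ω : Type*} [MeasurableSpace Ω] (X : ℝ≥0 → Ω → ℝ) (P : Measure Ω)
    (μ σ : ℝ) (ν : Measure ℝ) : Prop :=
  IsLevyMeasure ν ∧ ∀ (t : ℝ≥0) (θ : ℝ),
    ∫ ω, Complex.exp (Complex.I * θ * (X t ω : ℂ)) ∂P
      = Complex.exp (-((t : ℝ) : ℂ) * charExponent μ σ ν θ)

/-- `X` is a spectrally negative Lévy process with characteristics `(μ, σ, ν)`: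
`ν` does not charge `(0, ∞)`, and the case of monotone paths is excluded. -/
structure IsSpectrallyNegativeLevy {Ω : Type*} [MeasurableSpace Ω] (X : ℝ≥0 → Ω → ℝ)
    (P : Measure Ω) (μ σ : ℝ) (ν : Measure ℝ) : Prop where
  levy : IsLevyProcess X P
  characteristics : HasCharacteristics X P μ σ ν
  no_positive_jumps : ν (Set.Ioi 0) = 0
  not_nondecreasing : ¬ ∀ᵐ ω ∂P, Monotone (fun t => X t ω)
  not_nonincreasing : ¬ ∀ᵐ ω ∂P, Antitone (fun t => X t ω)

/-- The Laplace exponent `ψ(β) = log E[exp (β X_1)]`. -/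
def laplaceExponent {Ω : Type*} [MeasurableSpace Ω] (X : ℝ≥0 → Ω → ℝ) (P : Measure Ω)
    (β : ℝ) : ℝ :=
  cgf (X 1) P β

/-- `Φ(q) = sup {λ ≥ 0 : ψ(λ) = q}`. -/
def largestRoot (ψ : ℝ → ℝ) (q : ℝ) : ℝ :=
  sSup {l : ℝ | 0 ≤ l ∧ ψ l = q}

/-- `W` is the `q`-scale function of a spectrally negative Lévy process with Laplace exponent `ψ`:
a nonnegative function which vanishes on `(-∞, 0)`, is right continuous on `[0, ∞)`, and satisfies
`∫_0^∞ exp (-βx) W(x) dx = 1 / (ψ(β) - q)` for all `β > Φ(q)`. -/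
structure IsScaleFunction (ψ : ℝ → ℝ) (q : ℝ) (W : ℝ → ℝ) : Prop where
  nonneg : ∀ x, 0 ≤ W x
  eq_zero_of_neg : ∀ x, x < 0 → W x = 0
  right_continuous : ∀ x, 0 ≤ x → ContinuousWithinAt W (Set.Ici x) x
  integrable : ∀ β, largestRoot ψ q < β →
    IntegrableOn (fun x => Real.exp (-β * x) * W x) (Set.Ioi 0)
  laplace : ∀ β, largestRoot ψ q < β →
    ∫ x in Set.Ioi (0 : ℝ), Real.exp (-β * x) * W x = 1 / (ψ β - q)

/-- Almost surely, the paths of `X` have bounded variation on every compact time interval. -/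
def HasPathsOfBoundedVariation {Ω : Type*} [MeasurableSpace Ω] (X : ℝ≥0 → Ω → ℝ)
    (P : Measure Ω) : Prop :=
  ∀ᵐ ω ∂P, LocallyBoundedVariationOn (fun t => X t ω) Set.univ

/-- A pure jump subordinator: a Lévy process with nondecreasing paths which, almost surely, is
at all times the sum of its jumps so far. -/
structure IsPureJumpSubordinator {Ω : Type*} [MeasurableSpace Ω] (S : ℝ≥0 → Ω → ℝ)
    (P : Measure Ω) : Prop where
  levy : IsLevyProcess S P
  monotone : ∀ᵐ ω ∂P, Monotone (fun t => S t ω)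
  pure_jump : ∀ᵐ ω ∂P, ∀ t : ℝ≥0,
    HasSum (fun s : Set.Iic t => S s ω - Function.leftLim (fun u => S u ω) (s : ℝ≥0)) (S t ω)

/-- `X_t = δ t - S_t` for a pure jump subordinator `S`. -/
def HasDriftDecomposition {Ω : Type*} [MeasurableSpace Ω] (X : ℝ≥0 → Ω → ℝ) (P : Measure Ω)
    (δ : ℝ) : Prop :=
  ∃ S : ℝ≥0 → Ω → ℝ, IsPureJumpSubordinator S P ∧
    ∀ᵐ ω ∂P, ∀ t : ℝ≥0, X t ω = δ * t - S t ω

end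

/-!
Let `ψ` be the Laplace exponent. The initial value theorem for Laplace transforms, applied to the
right-continuous function `W`, gives `β / (ψ(β) - q) → W(0)` as `β → ∞`
(`IsScaleFunction.tendsto_zero`), so everything is decided by the growth of `ψ(β) / β`.

*Formula for `ψ`.* The process is given through its characteristic function only. Laws whose
triplets have the small jumps removed are convolutions of a Gaussian and a compound Poisson law, for
which both the characteristic function and the exponential moments are explicit. They converge
weakly to the law of `X_t`, and their exponential moments are bounded, so that
`E[exp (β X_t)] = exp (t ψ(β))` with `ψ(β) = -μβ + σ²β²/2 + ∫ (exp (βx) - 1 - βx 1_{|x| < 1}) ν(dx)`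
(`lintegral_exp_of_charFun`). Consequently `ψ(β) / β` tends to `δ = -μ - ∫_{(-1, 0)} x ν(dx)` if
`σ = 0` and `∫_{(-1, 0)} |x| ν(dx) < ∞`, and to `∞` otherwise.

*Bounded variation forces `σ = 0` and summable small jumps.* Let `V` be the variation of the path on
`[0, 1]`. The sums of `|X_{(i+1)/n} - X_{i/n}|` are at most `V < ∞`, whence by independence
`E[exp (-|X_{1/n}|)] ^ n` stays away from `0`, that is `n E[1 - exp (-|X_{1/n}|)]` is bounded
(`IsLevyProcess.exists_bound_of_boundedVariation`). The function
`x ↦ ∫_1^∞ (1 - cos (θx)) θ⁻² dθ` is comparable to `1 ∧ |x|`; testing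
`X_{1/n}` against it and letting `n → ∞` yields `∫_1^∞ Re Ψ(θ) θ⁻² dθ < ∞`, which rules out a Gaussian
part and bounds `∫_{(-1, 0)} |x| ν(dx)`.

*Conversely*, if `σ = 0` and the small jumps are summable, `S_t = δ t - X_t` satisfies
`E[exp (-β S_t)] = exp (-t κ(β)) ≤ 1` with `κ(β) = ∫ (1 - exp (βx)) ν(dx)`, which forces `S_t ≥ 0`
and hence nondecreasing paths. The mass of the diffuse part of a path on `[0, N]` is at most the
lower limit of the sums over fine grids of the increments truncated at `1 / β`
(`StieltjesFunction.measure_diff_atoms_le`), whose expectation is at most `2 N κ(β) / β → 0`; so the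
path is the sum of its jumps. The drift is positive because `X` does not have nonincreasing paths,
and it is unique because adding a linear function does not alter the jumps of a path.
-/

/-! ### Lévy measures and exponents -/

theorem IsLevyMeasure.integrable_min {ν : Measure ℝ} (hν : IsLevyMeasure ν) :
    Integrable (fun x : ℝ => min 1 (x ^ 2)) ν := by
  refine ⟨by fun_prop, ?_⟩
  rw [hasFiniteIntegral_iff_ofReal (ae_of_all _ fun x => by positivity)]
  exact hν.2

theorem IsLevyMeasure.integrable_of_bound {E : Type*} [NormedAddCommGroup E] {ν : Measure ℝ}
    (hν : IsLevyMeasure ν) {f : ℝ → E} (hf : AEStronglyMeasurable f ν) (C : ℝ)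
    (h : ∀ᵐ x ∂ν, ‖f x‖ ≤ C * min 1 (x ^ 2)) : Integrable f ν :=
  (hν.integrable_min.const_mul C).mono' hf h

theorem IsLevyMeasure.mono {ν ν' : Measure ℝ} (hν : IsLevyMeasure ν) (h : ν' ≤ ν) :
    IsLevyMeasure ν' :=
  ⟨le_antisymm ((h _).trans hν.1.le) bot_le, (lintegral_mono' h le_rfl).trans_lt hν.2⟩

theorem IsLevyMeasure.smul {ν : Measure ℝ} (hν : IsLevyMeasure ν) (c : ℝ≥0) :
    IsLevyMeasure (c • ν) := by
  refine ⟨by simp [hν.1], ?_⟩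
  rw [lintegral_smul_measure]
  exact ENNReal.mul_lt_top ENNReal.coe_lt_top hν.2

theorem IsLevyMeasure.measure_le_abs_lt_top {ν : Measure ℝ} (hν : IsLevyMeasure ν) {ε : ℝ}
    (hε : 0 < ε) : ν {x | ε ≤ |x|} < ⊤ := by
  have h := hν.integrable_min.measure_ge_lt_top (ε := min 1 (ε ^ 2)) (by positivity)
  refine (measure_mono ?_).trans_lt h
  intro x hx
  have hx' : ε ≤ |x| := hx
  have : ε ^ 2 ≤ x ^ 2 := by rw [← sq_abs x]; gcongr
  exact min_le_min le_rfl this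

/-- A Lévy measure is finite off every neighbourhood of `0` and does not charge `0`. This is what
allows Tonelli's theorem to be used with it. -/
theorem IsLevyMeasure.sigmaFinite {ν : Measure ℝ} (hν : IsLevyMeasure ν) : SigmaFinite ν := by
  refine ⟨⟨⟨fun n => {x | 1 / ((n : ℝ) + 1) ≤ |x|} ∪ {0}, fun _ => trivial, fun n => ?_, ?_⟩⟩⟩
  · exact measure_union_lt_top (hν.measure_le_abs_lt_top (by positivity)) (by simp [hν.1])
  · refine Set.eq_univ_of_forall fun x => Set.mem_iUnion.2 ?_
    rcases eq_or_ne x 0 with rfl | hx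
    · exact ⟨0, by simp⟩
    · obtain ⟨n, hn⟩ := exists_nat_one_div_lt (abs_pos.2 hx)
      exact ⟨n, Or.inl hn.le⟩

theorem IsLevyMeasure.ae_neg {ν : Measure ℝ} (hν : IsLevyMeasure ν) (h0 : ν (Set.Ioi 0) = 0) :
    ∀ᵐ x ∂ν, x < 0 := by
  rw [ae_iff]
  have : {x : ℝ | ¬ x < 0} = {0} ∪ Set.Ioi 0 := by
    ext x; simp [le_iff_eq_or_lt, eq_comm]
  rw [this]
  exact measure_union_null hν.1 h0

/-- The integrand `1 - exp (iθx) + iθx 1_{|x| < 1}` of the characteristic exponent. -/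
noncomputable def charIntegrand (θ x : ℝ) : ℂ :=
  1 - Complex.exp (Complex.I * θ * x) +
      Set.indicator {y : ℝ | |y| < 1} (fun y : ℝ => Complex.I * θ * y) x

theorem measurableSet_abs_lt_one : MeasurableSet {y : ℝ | |y| < 1} :=
  measurableSet_lt (by fun_prop) (by fun_prop)

theorem measurable_charIntegrand (θ : ℝ) : Measurable (charIntegrand θ) := by
  unfold charIntegrand
  exact (by fun_prop : Measurable fun x : ℝ => 1 - Complex.exp (Complex.I * θ * x)).add
    ((by fun_prop : Measurable fun y : ℝ => Complex.I * θ * y).indicator measurableSet_abs_lt_one)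

theorem norm_charIntegrand_le (θ x : ℝ) :
    ‖charIntegrand θ x‖ ≤ (2 + 3 * θ ^ 2) * min 1 (x ^ 2) := by
  have hn : ‖Complex.exp (Complex.I * θ * x)‖ = 1 := by
    rw [show Complex.I * θ * x = ((θ * x : ℝ) : ℂ) * Complex.I by push_cast; ring]
    exact Complex.norm_exp_ofReal_mul_I _
  have hu : ‖Complex.I * θ * x‖ = |θ * x| := by simp [abs_mul]
  unfold charIntegrand
  by_cases hx : |x| < 1
  · have hmem : x ∈ {y : ℝ | |y| < 1} := hx
    rw [Set.indicator_of_mem hmem]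
    have hx2 : x ^ 2 ≤ 1 := by rw [← sq_abs]; nlinarith [abs_nonneg x]
    rw [min_eq_right hx2]
    have key : ‖(1 : ℂ) - Complex.exp (Complex.I * θ * x) + Complex.I * θ * x‖ ≤
        3 * (θ * x) ^ 2 := by
      rw [show (1 : ℂ) - Complex.exp (Complex.I * θ * x) + Complex.I * θ * x =
        -(Complex.exp (Complex.I * θ * x) - 1 - Complex.I * θ * x) by ring, norm_neg]
      rcases le_total (|θ * x|) 1 with h | h
      · have := Complex.norm_exp_sub_one_sub_id_le (x := Complex.I * θ * x) (by rw [hu]; exact h)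
        rw [hu, sq_abs] at this
        nlinarith [sq_nonneg (θ * x)]
      · calc _ ≤ ‖Complex.exp (Complex.I * θ * x)‖ + ‖(1 : ℂ)‖ + ‖Complex.I * θ * x‖ :=
              (norm_sub_le _ _).trans (add_le_add_left (norm_sub_le _ _) _)
          _ = 1 + 1 + |θ * x| := by rw [hn, hu, norm_one]
          _ ≤ 3 * (θ * x) ^ 2 := by rw [← sq_abs (θ * x)]; nlinarith
    refine key.trans ?_
    nlinarith [sq_nonneg x]
  · have hmem : x ∉ {y : ℝ | |y| < 1} := hx
    rw [Set.indicator_of_notMem hmem, add_zero]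
    have hx2 : 1 ≤ x ^ 2 := by rw [← sq_abs]; nlinarith [not_lt.1 hx]
    rw [min_eq_left hx2]
    calc _ ≤ ‖(1 : ℂ)‖ + ‖Complex.exp (Complex.I * θ * x)‖ := norm_sub_le _ _
      _ = 2 := by rw [hn, norm_one]; norm_num
      _ ≤ _ := by nlinarith [sq_nonneg θ]

theorem IsLevyMeasure.integrable_charIntegrand {ν : Measure ℝ} (hν : IsLevyMeasure ν) (θ : ℝ) :
    Integrable (charIntegrand θ) ν :=
  hν.integrable_of_bound (measurable_charIntegrand θ).aestronglyMeasurable _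
    (ae_of_all _ (norm_charIntegrand_le θ))

/-- The integrand `exp (βx) - 1 - βx 1_{|x| < 1}` of the Laplace exponent. -/
noncomputable def lapIntegrand (β x : ℝ) : ℝ :=
  Real.exp (β * x) - 1 - Set.indicator {y : ℝ | |y| < 1} (fun y : ℝ => β * y) x

/-- The Laplace exponent attached to the triplet `(μ, σ, ν)`, that is `-Ψ(-iβ)`. It is meaningful
for `β ≥ 0` and `ν` carried by `(-∞, 0)`, when the integral converges. -/
noncomputable def lapExponent (μ σ : ℝ) (ν : Measure ℝ) (β : ℝ) : ℝ :=
  -μ * β + σ ^ 2 / 2 * β ^ 2 + ∫ x, lapIntegrand β x ∂ν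

theorem measurable_lapIntegrand (β : ℝ) : Measurable (lapIntegrand β) := by
  unfold lapIntegrand
  exact (by fun_prop : Measurable fun x : ℝ => Real.exp (β * x) - 1).sub
    ((by fun_prop : Measurable fun y : ℝ => β * y).indicator measurableSet_abs_lt_one)

theorem abs_lapIntegrand_le {β x : ℝ} (hβ : 0 ≤ β) (hx : x < 0) :
    ‖lapIntegrand β x‖ ≤ (1 + β ^ 2) * min 1 (x ^ 2) := by
  rw [Real.norm_eq_abs]
  unfold lapIntegrand
  have hbx : β * x ≤ 0 := mul_nonpos_of_nonneg_of_nonpos hβ hx.le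
  have he : Real.exp (β * x) ≤ 1 := Real.exp_le_one_iff.2 hbx
  have he0 := Real.exp_pos (β * x)
  by_cases h1 : |x| < 1
  · have hmem : x ∈ {y : ℝ | |y| < 1} := h1
    rw [Set.indicator_of_mem hmem]
    have hx2 : x ^ 2 ≤ 1 := by rw [← sq_abs]; nlinarith [abs_nonneg x]
    rw [min_eq_right hx2]
    have hlow := Real.add_one_le_exp (β * x)
    rw [abs_of_nonneg (by linarith)]
    have key : Real.exp (β * x) - 1 - β * x ≤ (β * x) ^ 2 := by
      rcases le_total (-1) (β * x) with h | h
      · have := Real.abs_exp_sub_one_sub_id_le (x := β * x) (by rw [abs_of_nonpos hbx]; linarith)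
        exact (le_abs_self _).trans this
      · nlinarith
    nlinarith [sq_nonneg x]
  · have hmem : x ∉ {y : ℝ | |y| < 1} := h1
    rw [Set.indicator_of_notMem hmem, sub_zero]
    have hx2 : 1 ≤ x ^ 2 := by rw [← sq_abs]; nlinarith [not_lt.1 h1]
    rw [min_eq_left hx2, abs_of_nonpos (by linarith)]
    nlinarith [sq_nonneg β]

theorem IsLevyMeasure.integrable_lapIntegrand {ν : Measure ℝ} (hν : IsLevyMeasure ν)
    (h0 : ν (Set.Ioi 0) = 0) {β : ℝ} (hβ : 0 ≤ β) : Integrable (lapIntegrand β) ν :=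
  hν.integrable_of_bound (measurable_lapIntegrand β).aestronglyMeasurable _
    ((hν.ae_neg h0).mono fun _ hx => abs_lapIntegrand_le hβ hx)

theorem charExponent_eq (μ σ : ℝ) (ν : Measure ℝ) (θ : ℝ) :
    charExponent μ σ ν θ = Complex.I * μ * θ + (σ : ℂ) ^ 2 / 2 * (θ : ℂ) ^ 2 +
      ∫ x : ℝ, charIntegrand θ x ∂ν := rfl

/-- The triplet of `X_t` is `t` times that of `X_1`, the volatility being multiplied by `√t`. -/
theorem charExponent_scale (μ σ : ℝ) (ν : Measure ℝ) (t : ℝ≥0) (θ : ℝ) :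
    charExponent (t * μ) (Real.sqrt t * σ) (t • ν) θ = (t : ℝ) * charExponent μ σ ν θ := by
  have h : ((Real.sqrt t : ℝ) : ℂ) ^ 2 = ((t : ℝ) : ℂ) := by
    rw [← Complex.ofReal_pow, Real.sq_sqrt t.coe_nonneg]
  rw [charExponent_eq, charExponent_eq, integral_smul_nnreal_measure]
  push_cast
  rw [mul_pow, h, NNReal.smul_def, Complex.real_smul]
  ring

theorem lapExponent_scale (μ σ : ℝ) (ν : Measure ℝ) (t : ℝ≥0) (β : ℝ) :
    lapExponent (t * μ) (Real.sqrt t * σ) (t • ν) β = t * lapExponent μ σ ν β := by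
  unfold lapExponent
  rw [integral_smul_nnreal_measure, mul_pow, Real.sq_sqrt t.coe_nonneg, NNReal.smul_def, smul_eq_mul]
  ring

/-! ### Exponential moments from the characteristic function -/

open Measure in
/-- The `k`-fold convolution power of a measure on `ℝ`. -/
noncomputable def convPow (ν : Measure ℝ) : ℕ → Measure ℝ
  | 0 => dirac 0
  | k + 1 => Measure.conv ν (convPow ν k)

instance convPow.isFiniteMeasure (ν : Measure ℝ) [IsFiniteMeasure ν] (k : ℕ) :
    IsFiniteMeasure (convPow ν k) := by
  induction k with
  | zero => unfold convPow; infer_instance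
  | succ k ih => unfold convPow; infer_instance

theorem lintegral_exp_conv (p r : Measure ℝ) [SFinite r] (β : ℝ) :
    ∫⁻ x, ENNReal.ofReal (Real.exp (β * x)) ∂(Measure.conv p r) =
      (∫⁻ x, ENNReal.ofReal (Real.exp (β * x)) ∂p) *
        ∫⁻ x, ENNReal.ofReal (Real.exp (β * x)) ∂r := by
  rw [Measure.lintegral_conv (by fun_prop), ← lintegral_mul_const _ (by fun_prop)]
  refine lintegral_congr fun x => ?_
  rw [← lintegral_const_mul _ (by fun_prop)]
  refine lintegral_congr fun y => ?_
  rw [← ENNReal.ofReal_mul (Real.exp_pos _).le, ← Real.exp_add, mul_add]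

theorem lintegral_exp_convPow (ν : Measure ℝ) [IsFiniteMeasure ν] (β : ℝ) (k : ℕ) :
    ∫⁻ x, ENNReal.ofReal (Real.exp (β * x)) ∂(convPow ν k) =
      (∫⁻ x, ENNReal.ofReal (Real.exp (β * x)) ∂ν) ^ k := by
  induction k with
  | zero => simp [convPow]
  | succ k ih => rw [convPow, lintegral_exp_conv, ih, pow_succ']

theorem charFun_convPow (ν : Measure ℝ) [IsFiniteMeasure ν] (θ : ℝ) (k : ℕ) :
    charFun (convPow ν k) θ = (charFun ν θ) ^ k := by
  induction k with
  | zero => simp [convPow, charFun_dirac]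
  | succ k ih => rw [convPow, charFun_conv, ih, pow_succ']

/-- The compound Poisson law with finite jump measure `ν`:
`∑ₖ exp (-ν(ℝ)) / k! • ν^{*k}`. -/
noncomputable def compoundPoisson (ν : Measure ℝ) : Measure ℝ :=
  Measure.sum fun k : ℕ =>
    ENNReal.ofReal (Real.exp (-ν.real Set.univ) / k.factorial) • convPow ν k

/-- For `β = 0` this says that the total mass is `1`. -/
theorem lintegral_exp_compoundPoisson (ν : Measure ℝ) [IsFiniteMeasure ν] {β : ℝ}
    (h : Integrable (fun x => Real.exp (β * x)) ν) :
    ∫⁻ x, ENNReal.ofReal (Real.exp (β * x)) ∂(compoundPoisson ν) =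
      ENNReal.ofReal (Real.exp (∫ x, (Real.exp (β * x) - 1) ∂ν)) := by
  have hr : ∫⁻ x, ENNReal.ofReal (Real.exp (β * x)) ∂ν =
      ENNReal.ofReal (∫ x, Real.exp (β * x) ∂ν) :=
    (ofReal_integral_eq_lintegral_ofReal h (ae_of_all _ fun x => (Real.exp_pos _).le)).symm
  have hr0 : 0 ≤ ∫ x, Real.exp (β * x) ∂ν := integral_nonneg fun x => (Real.exp_pos _).le
  unfold compoundPoisson
  rw [lintegral_sum_measure]
  simp_rw [lintegral_smul_measure, lintegral_exp_convPow, hr, smul_eq_mul]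
  rw [integral_sub h (integrable_const 1), integral_const, smul_eq_mul, mul_one]
  have hs := NormedSpace.expSeries_div_hasSum_exp (∫ x, Real.exp (β * x) ∂ν)
  rw [← Real.exp_eq_exp_ℝ] at hs
  replace hs := hs.mul_left (Real.exp (-ν.real Set.univ))
  rw [← Real.exp_add, neg_add_eq_sub] at hs
  rw [← hs.tsum_eq, ENNReal.ofReal_tsum_of_nonneg (fun k => by positivity) hs.summable]
  refine tsum_congr fun k => ?_
  rw [← ENNReal.ofReal_pow hr0, ← ENNReal.ofReal_mul (by positivity)]
  congr 1
  ring

theorem lintegral_exp_zero (p : Measure ℝ) :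
    ∫⁻ x, ENNReal.ofReal (Real.exp (0 * x)) ∂p = p Set.univ := by
  simp

instance compoundPoisson.isProbabilityMeasure (ν : Measure ℝ) [IsFiniteMeasure ν] :
    IsProbabilityMeasure (compoundPoisson ν) := by
  constructor
  rw [← lintegral_exp_zero, lintegral_exp_compoundPoisson ν (by simp)]
  simp

theorem integrable_charFun_kernel (p : Measure ℝ) [IsFiniteMeasure p] (θ : ℝ) :
    Integrable (fun x : ℝ => Complex.exp (θ * x * Complex.I)) p := by
  refine Integrable.of_bound (C := 1) (by fun_prop) (ae_of_all _ fun x => ?_)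
  rw [← Complex.ofReal_mul, Complex.norm_exp_ofReal_mul_I]

theorem charFun_compoundPoisson (ν : Measure ℝ) [IsFiniteMeasure ν] (θ : ℝ) :
    charFun (compoundPoisson ν) θ = Complex.exp (charFun ν θ - ν.real Set.univ) := by
  have hi := integrable_charFun_kernel (compoundPoisson ν) θ
  have h1 := hasSum_integral_measure hi
  rw [charFun_apply_real]
  refine h1.unique ?_
  have hs := NormedSpace.expSeries_div_hasSum_exp (charFun ν θ)
  rw [← Complex.exp_eq_exp_ℂ] at hs
  replace hs := hs.mul_left (Complex.exp (-ν.real Set.univ))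
  rw [← Complex.exp_add, neg_add_eq_sub] at hs
  have e : (fun k : ℕ => Complex.exp (-ν.real Set.univ) * (charFun ν θ ^ k / k.factorial)) =
      fun k : ℕ => ∫ x : ℝ, Complex.exp (θ * x * Complex.I)
        ∂(ENNReal.ofReal (Real.exp (-ν.real Set.univ) / k.factorial) • convPow ν k) := by
    funext k
    rw [integral_smul_measure, ← charFun_apply_real, charFun_convPow,
    ENNReal.toReal_ofReal (by positivity), Complex.real_smul]
    push_cast
    ring
  rw [e] at hs
  exact hs

/-- Law with prescribed triplet, for finite `ν`: a Gaussian law convolved with a compound Poisson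
law. -/
theorem exists_law_of_finite (μ σ : ℝ) (ν : Measure ℝ) [IsFiniteMeasure ν]
    (hν : IsLevyMeasure ν) (h0 : ν (Set.Ioi 0) = 0) :
    ∃ p : ProbabilityMeasure ℝ, (∀ θ, charFun (p : Measure ℝ) θ =
        Complex.exp (-charExponent μ σ ν θ)) ∧
      ∀ β, 0 ≤ β → ∫⁻ x, ENNReal.ofReal (Real.exp (β * x)) ∂(p : Measure ℝ) =
        ENNReal.ofReal (Real.exp (lapExponent μ σ ν β)) := by
  set m : ℝ := ∫ x, Set.indicator {y : ℝ | |y| < 1} (fun y : ℝ => y) x ∂ν with hm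
  set v : ℝ≥0 := ⟨σ ^ 2, sq_nonneg σ⟩ with hv
  have hind : Integrable (Set.indicator {y : ℝ | |y| < 1} (fun y : ℝ => y)) ν := by
    refine Integrable.of_bound (C := 1)
      (measurable_id.indicator measurableSet_abs_lt_one).aestronglyMeasurable
      (ae_of_all _ fun x => ?_)
    by_cases hx : |x| < 1
    · rw [Set.indicator_of_mem (show x ∈ {y : ℝ | |y| < 1} from hx)]; exact hx.le
    · rw [Set.indicator_of_notMem (show x ∉ {y : ℝ | |y| < 1} from hx)]; simp
  refine ⟨⟨Measure.conv (gaussianReal (-μ - m) v) (compoundPoisson ν), inferInstance⟩,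
    fun θ => ?_, fun β hβ => ?_⟩
  · have hk := integrable_charFun_kernel ν θ
    have hint : ∫ x, charIntegrand θ x ∂ν =
        ν.real Set.univ - charFun ν θ + Complex.I * θ * (m : ℂ) := by
      have : charIntegrand θ = fun x : ℝ => ((1 : ℂ) - Complex.exp (θ * x * Complex.I)) +
          Complex.I * θ * ((Set.indicator {y : ℝ | |y| < 1} (fun y : ℝ => y) x : ℝ) : ℂ) := by
        funext x
        unfold charIntegrand
        congr 1
        · congr 2; ring
        · by_cases hx : |x| < 1
          · simp [Set.indicator, hx]
          · simp [Set.indicator, hx]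
      have hk' : Integrable (fun x : ℝ => (1 : ℂ) - Complex.exp (θ * x * Complex.I)) ν :=
        (integrable_const 1).sub hk
      have hind' : Integrable (fun x : ℝ => Complex.I * θ *
          ((Set.indicator {y : ℝ | |y| < 1} (fun y : ℝ => y) x : ℝ) : ℂ)) ν :=
        hind.ofReal.const_mul _
      simp only [this]
      rw [integral_add hk' hind',
        integral_sub (integrable_const 1) hk, integral_const_mul, integral_complex_ofReal,
        charFun_apply_real, integral_const]
      simp only [Complex.real_smul, mul_one]
      rfl
    change charFun (Measure.conv (gaussianReal (-μ - m) v) (compoundPoisson ν)) θ = _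
    rw [charFun_conv, charFun_gaussianReal, charFun_compoundPoisson, ← Complex.exp_add,
      charExponent_eq, hint]
    have hvv : ((v : ℝ) : ℂ) = (σ : ℂ) ^ 2 := by
      rw [← Complex.ofReal_pow]; rfl
    congr 1
    rw [hvv]
    push_cast
    ring
  · have hexp : Integrable (fun x => Real.exp (β * x)) ν := by
      refine Integrable.of_bound (C := 1) (by fun_prop) ((hν.ae_neg h0).mono fun x hx => ?_)
      rw [Real.norm_eq_abs, abs_of_pos (Real.exp_pos _), Real.exp_le_one_iff]
      exact mul_nonpos_of_nonneg_of_nonpos hβ hx.le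
    have hint : ∫ x, lapIntegrand β x ∂ν = (∫ x, (Real.exp (β * x) - 1) ∂ν) - β * m := by
      have : lapIntegrand β = fun x : ℝ => (Real.exp (β * x) - 1) -
          β * Set.indicator {y : ℝ | |y| < 1} (fun y : ℝ => y) x := by
        funext x
        unfold lapIntegrand
        by_cases hx : |x| < 1
        · simp [Set.indicator, hx]
        · simp [Set.indicator, hx]
      have hexp' : Integrable (fun x : ℝ => Real.exp (β * x) - 1) ν :=
        hexp.sub (integrable_const 1)
      simp only [this]
      rw [integral_sub hexp' (hind.const_mul _),
        integral_const_mul]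
    change ∫⁻ x, _ ∂(Measure.conv (gaussianReal (-μ - m) v) (compoundPoisson ν)) = _
    rw [lintegral_exp_conv, lintegral_exp_compoundPoisson ν hexp,
      ← ofReal_integral_eq_lintegral_ofReal (integrable_exp_mul_gaussianReal β)
        (ae_of_all _ fun x => (Real.exp_pos _).le)]
    have hg : ∫ x, Real.exp (β * x) ∂(gaussianReal (-μ - m) v) =
        Real.exp ((-μ - m) * β + v * β ^ 2 / 2) :=
      mgf_gaussianReal (X := id) (p := gaussianReal (-μ - m) v) Measure.map_id β
    rw [hg, ← ENNReal.ofReal_mul (Real.exp_pos _).le, ← Real.exp_add]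
    have hvv : (v : ℝ) = σ ^ 2 := rfl
    congr 2
    rw [lapExponent, hint, hvv]
    ring

/-- Removing the jumps of size less than `1 / (n + 1)` changes integrals by a vanishing amount. -/
theorem IsLevyMeasure.tendsto_setIntegral {E : Type*} [NormedAddCommGroup E] [NormedSpace ℝ E]
    {ν : Measure ℝ} (hν : IsLevyMeasure ν) {f : ℝ → E} (hf : Integrable f ν) :
    Tendsto (fun n : ℕ => ∫ x in {x : ℝ | 1 / ((n : ℝ) + 1) ≤ |x|}, f x ∂ν) atTop
      (𝓝 (∫ x, f x ∂ν)) := by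
  have h := tendsto_setIntegral_of_monotone (μ := ν) (f := f)
    (s := fun n : ℕ => {x : ℝ | 1 / ((n : ℝ) + 1) ≤ |x|})
    (fun n => measurableSet_le measurable_const (by fun_prop))
    (fun m n hmn x hx => by
      simp only [Set.mem_ofPred_eq] at hx ⊢
      exact (Nat.one_div_le_one_div hmn).trans hx) hf.integrableOn
  have hU : ⋃ n : ℕ, {x : ℝ | 1 / ((n : ℝ) + 1) ≤ |x|} = {0}ᶜ := by
    ext x
    simp only [Set.mem_iUnion, Set.mem_ofPred_eq, Set.mem_compl_iff, Set.mem_singleton_iff]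
    constructor
    · rintro ⟨n, hn⟩ rfl
      rw [abs_zero] at hn
      exact absurd hn (not_le.2 Nat.one_div_pos_of_nat)
    · intro hx
      obtain ⟨n, hn⟩ := exists_nat_one_div_lt (abs_pos.2 hx)
      exact ⟨n, hn.le⟩
  rw [hU] at h
  rwa [setIntegral_eq_integral_of_ae_compl_eq_zero] at h
  rw [ae_iff]
  refine measure_mono_null (fun x hx => ?_) hν.1
  simp at hx
  simp [hx.1]

/-- A law on `ℝ` with the characteristic function of a spectrally negative triplet has all
exponential moments of nonnegative order, and these are given by the Laplace exponent.

The law is the weak limit, by Lévy's continuity theorem, of the laws whose triplets have their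
small jumps removed. For these the formula is explicit, and the exponential moments of order `2β`
stay bounded, which makes `exp (βx)` uniformly integrable along the sequence. -/
theorem lintegral_exp_of_charFun {μ σ : ℝ} {ν : Measure ℝ} (hν : IsLevyMeasure ν)
    (h0 : ν (Set.Ioi 0) = 0) (p : Measure ℝ) [IsProbabilityMeasure p]
    (hp : ∀ θ, charFun p θ = Complex.exp (-charExponent μ σ ν θ)) {β : ℝ} (hβ : 0 ≤ β) :
    ∫⁻ x, ENNReal.ofReal (Real.exp (β * x)) ∂p =
      ENNReal.ofReal (Real.exp (lapExponent μ σ ν β)) := by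
  set A : ℕ → Set ℝ := fun n => {x : ℝ | 1 / ((n : ℝ) + 1) ≤ |x|} with hA
  have hfin : ∀ n, IsFiniteMeasure (ν.restrict (A n)) := fun n =>
    ⟨by rw [Measure.restrict_apply_univ]; exact hν.measure_le_abs_lt_top Nat.one_div_pos_of_nat⟩
  have hex := fun n => @exists_law_of_finite μ σ (ν.restrict (A n)) (hfin n)
    (hν.mono Measure.restrict_le_self)
    (le_antisymm ((Measure.restrict_le_self _).trans h0.le) bot_le)
  choose r hrc hrl using hex
  obtain ⟨p', rfl⟩ : ∃ p' : ProbabilityMeasure ℝ, (p' : Measure ℝ) = p :=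
    ⟨⟨p, inferInstance⟩, rfl⟩
  have hconv : Tendsto r atTop (𝓝 p') := by
    rw [ProbabilityMeasure.tendsto_iff_tendsto_charFun]
    intro θ
    simp_rw [hrc]
    rw [hp]
    refine (Complex.continuous_exp.tendsto _).comp (Tendsto.neg ?_)
    simp_rw [charExponent_eq]
    exact tendsto_const_nhds.add (hν.tendsto_setIntegral (hν.integrable_charIntegrand θ))
  have hlap : ∀ b, 0 ≤ b → Tendsto (fun n => ENNReal.ofReal (Real.exp
      (lapExponent μ σ (ν.restrict (A n)) b))) atTop
      (𝓝 (ENNReal.ofReal (Real.exp (lapExponent μ σ ν b)))) := by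
    intro b hb
    refine (ENNReal.continuous_ofReal.tendsto _).comp ((Real.continuous_exp.tendsto _).comp ?_)
    unfold lapExponent
    exact tendsto_const_nhds.add (hν.tendsto_setIntegral (hν.integrable_lapIntegrand h0 hb))
  -- the truncated exponentials `min (exp (b x)) K`
  let f : ℝ → ℝ≥0 → BoundedContinuousFunction ℝ ℝ≥0 := fun b K =>
    BoundedContinuousFunction.mkOfBound
      ⟨fun x => min (Real.toNNReal (Real.exp (b * x))) K, by fun_prop⟩ K (fun x y => by
        have hx : min (Real.toNNReal (Real.exp (b * x))) K ≤ K := min_le_right _ _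
        have hy : min (Real.toNNReal (Real.exp (b * y))) K ≤ K := min_le_right _ _
        rw [NNReal.dist_eq, abs_le]
        have hx' := NNReal.coe_le_coe.2 hx
        have hy' := NNReal.coe_le_coe.2 hy
        have hx0 := NNReal.coe_nonneg (min (Real.toNNReal (Real.exp (b * x))) K)
        have hy0 := NNReal.coe_nonneg (min (Real.toNNReal (Real.exp (b * y))) K)
        simp only [ContinuousMap.coe_mk]
        constructor <;> linarith)
  have hf : ∀ b K x, ((f b K x : ℝ≥0) : ℝ≥0∞) = min (ENNReal.ofReal (Real.exp (b * x))) K :=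
    fun b K x => ENNReal.coe_min _ _
  have hft : ∀ (b : ℝ) (K : ℝ≥0), Tendsto
      (fun n => ∫⁻ x, min (ENNReal.ofReal (Real.exp (b * x))) K ∂(r n : Measure ℝ)) atTop
      (𝓝 (∫⁻ x, min (ENNReal.ofReal (Real.exp (b * x))) K ∂(p' : Measure ℝ))) := by
    intro b K
    have := ProbabilityMeasure.tendsto_iff_forall_lintegral_tendsto.1 hconv (f b K)
    simp_rw [hf] at this
    exact this
  have hsup : ∀ b : ℝ, Tendsto (fun k : ℕ =>
      ∫⁻ x, min (ENNReal.ofReal (Real.exp (b * x))) ((k : ℝ≥0) : ℝ≥0∞) ∂(p' : Measure ℝ)) atTop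
      (𝓝 (∫⁻ x, ENNReal.ofReal (Real.exp (b * x)) ∂(p' : Measure ℝ))) := by
    intro b
    refine lintegral_tendsto_of_tendsto_of_monotone (fun k => by fun_prop)
      (ae_of_all _ fun x k l hkl => min_le_min le_rfl (by gcongr))
      (ae_of_all _ fun x => ?_)
    obtain ⟨k, hk⟩ := exists_nat_ge (Real.exp (b * x))
    refine tendsto_const_nhds.congr' ?_
    filter_upwards [eventually_ge_atTop k] with l hl
    rw [min_eq_left]
    have : Real.exp (b * x) ≤ l := hk.trans (by exact_mod_cast hl)
    simpa using ENNReal.ofReal_le_ofReal this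
  apply le_antisymm
  -- upper bound: truncate at level `k`, pass to the limit in `n`, then let `k` grow
  · refine le_of_tendsto (hsup β) (Eventually.of_forall fun k => ?_)
    refine le_of_tendsto_of_tendsto (hft β k) (hlap β hβ) (Eventually.of_forall fun n => ?_)
    simp only
    rw [← hrl n β hβ]
    exact lintegral_mono fun x => min_le_left _ _
  -- lower bound: the error of the truncation at level `k` is at most the moment of order `2β`
  -- divided by `k`
  · set L2 := ENNReal.ofReal (Real.exp (lapExponent μ σ ν (2 * β))) with hL2
    have hk : ∀ k : ℕ, 1 ≤ k → ENNReal.ofReal (Real.exp (lapExponent μ σ ν β)) ≤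
        (∫⁻ x, ENNReal.ofReal (Real.exp (β * x)) ∂(p' : Measure ℝ)) + ((k : ℝ≥0∞))⁻¹ * L2 := by
      intro k hk
      have hk0 : (k : ℝ≥0∞)⁻¹ ≠ ⊤ := by simp; omega
      have hlim := (hft β k).add (ENNReal.Tendsto.const_mul
        (hlap (2 * β) (by linarith)) (Or.inr hk0))
      refine (le_of_tendsto_of_tendsto (hlap β hβ) hlim (Eventually.of_forall fun n => ?_)).trans
        (add_le_add (lintegral_mono fun x => min_le_left _ _) le_rfl)
      simp only
      rw [← hrl n β hβ, ← hrl n (2 * β) (by linarith), ← lintegral_const_mul _ (by fun_prop),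
        ← lintegral_add_left (by fun_prop)]
      refine lintegral_mono fun x => ?_
      -- `exp (b x) ≤ min (exp (b x)) k + exp (2 b x) / k`
      rcases le_total (Real.exp (β * x)) k with h | h
      · rw [min_eq_left]
        · exact le_self_add
        · simpa using ENNReal.ofReal_le_ofReal h
      · refine le_trans ?_ le_add_self
        have hkpos : (0 : ℝ) < k := by exact_mod_cast hk
        rw [← ENNReal.ofReal_natCast, ← ENNReal.ofReal_inv_of_pos hkpos,
          ← ENNReal.ofReal_mul (by positivity)]
        apply ENNReal.ofReal_le_ofReal
        rw [mul_assoc, two_mul, Real.exp_add, inv_mul_eq_div, le_div_iff₀ hkpos]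
        exact mul_le_mul_of_nonneg_left h (Real.exp_pos _).le
    have hlim : Tendsto (fun k : ℕ => (∫⁻ x, ENNReal.ofReal (Real.exp (β * x)) ∂(p' : Measure ℝ)) +
        ((k : ℝ≥0∞))⁻¹ * L2) atTop (𝓝 ((∫⁻ x, ENNReal.ofReal (Real.exp (β * x)) ∂(p' : Measure ℝ)) + 0 * L2)) :=
      tendsto_const_nhds.add (ENNReal.Tendsto.mul_const ENNReal.tendsto_inv_nat_nhds_zero
        (Or.inr ENNReal.ofReal_ne_top))
    rw [zero_mul, add_zero] at hlim
    exact ge_of_tendsto hlim ((eventually_ge_atTop 1).mono hk)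

/-! ### The Laplace exponent and its growth -/

section Laplace

variable {Ω : Type*} [MeasurableSpace Ω] {P : Measure Ω}
  {X : ℝ≥0 → Ω → ℝ} {μ σ : ℝ} {ν : Measure ℝ}

theorem IsSpectrallyNegativeLevy.isLevyMeasure (hX : IsSpectrallyNegativeLevy X P μ σ ν) :
    IsLevyMeasure ν := hX.characteristics.1

theorem IsSpectrallyNegativeLevy.charFun_map (hX : IsSpectrallyNegativeLevy X P μ σ ν) (t : ℝ≥0)
    (θ : ℝ) : charFun (P.map (X t)) θ = Complex.exp (-((t : ℝ) * charExponent μ σ ν θ)) := by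
  rw [charFun_apply_real, integral_map (hX.levy.measurable t).aemeasurable (by fun_prop),
    ← neg_mul, ← hX.characteristics.2 t θ]
  refine integral_congr_ae (ae_of_all _ fun ω => ?_)
  simp only
  congr 1
  ring

variable [IsProbabilityMeasure P]

/-- `E[exp (β X_t)] = exp (t ψ(β))` for `β ≥ 0`. -/
theorem IsSpectrallyNegativeLevy.lintegral_exp (hX : IsSpectrallyNegativeLevy X P μ σ ν)
    (t : ℝ≥0) {β : ℝ} (hβ : 0 ≤ β) :
    ∫⁻ ω, ENNReal.ofReal (Real.exp (β * X t ω)) ∂P =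
      ENNReal.ofReal (Real.exp (t * lapExponent μ σ ν β)) := by
  have hp : IsProbabilityMeasure (P.map (X t)) :=
    Measure.isProbabilityMeasure_map (hX.levy.measurable t).aemeasurable
  have h0 : (t • ν) (Set.Ioi 0) = 0 := by simp [hX.no_positive_jumps]
  have h := lintegral_exp_of_charFun (μ := t * μ) (σ := Real.sqrt t * σ)
    (hX.isLevyMeasure.smul t) h0 (P.map (X t))
    (fun θ => by rw [charExponent_scale, hX.charFun_map]) hβ
  rwa [lintegral_map (by fun_prop) (hX.levy.measurable t), lapExponent_scale] at h

theorem IsSpectrallyNegativeLevy.laplaceExponent_eq (hX : IsSpectrallyNegativeLevy X P μ σ ν)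
    {β : ℝ} (hβ : 0 ≤ β) : laplaceExponent X P β = lapExponent μ σ ν β := by
  have h := hX.lintegral_exp 1 hβ
  have hm := hX.levy.measurable 1
  rw [laplaceExponent, cgf, mgf, integral_eq_lintegral_of_nonneg_ae
    (ae_of_all _ fun ω => (Real.exp_pos _).le) (by fun_prop), h,
    ENNReal.toReal_ofReal (Real.exp_pos _).le, Real.log_exp]
  simp

end Laplace

section Asymptotics

variable {μ σ : ℝ} {ν : Measure ℝ}

/-- The Laplace exponent `κ(β) = ∫ (1 - exp (βx)) ν(dx)` of the subordinator with jumps `|x|`. -/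
noncomputable def subExponent (ν : Measure ℝ) (β : ℝ) : ℝ := ∫ x, (1 - Real.exp (β * x)) ∂ν

/-- The drift `-μ - ∫_{(-1, 0)} x ν(dx)` in the case of finite small jump variation. -/
noncomputable def driftCoeff (μ : ℝ) (ν : Measure ℝ) : ℝ := -μ - ∫ x in Set.Ioo (-1 : ℝ) 0, x ∂ν

theorem IsLevyMeasure.integrableOn_id (h : ∫⁻ x in Set.Ioo (-1 : ℝ) 0, ENNReal.ofReal |x| ∂ν ≠ ⊤) :
    IntegrableOn (fun x : ℝ => x) (Set.Ioo (-1 : ℝ) 0) ν := by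
  refine ⟨by fun_prop, ?_⟩
  rw [hasFiniteIntegral_iff_norm]
  exact lt_top_iff_ne_top.2 h

theorem IsLevyMeasure.integrable_min_abs (hν : IsLevyMeasure ν) (h0 : ν (Set.Ioi 0) = 0)
    (h : ∫⁻ x in Set.Ioo (-1 : ℝ) 0, ENNReal.ofReal |x| ∂ν ≠ ⊤) :
    Integrable (fun x : ℝ => min 1 |x|) ν := by
  have h1 := ((IsLevyMeasure.integrableOn_id h).integrable_indicator measurableSet_Ioo).norm
  refine (h1.add hν.integrable_min).mono' (by fun_prop) ((hν.ae_neg h0).mono fun x hx => ?_)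
  rw [Real.norm_eq_abs, abs_of_nonneg (by positivity)]
  simp only [Pi.add_apply]
  by_cases hx1 : -1 < x
  · rw [Set.indicator_of_mem (show x ∈ Set.Ioo (-1 : ℝ) 0 from ⟨hx1, hx⟩), Real.norm_eq_abs]
    have : 0 ≤ min 1 (x ^ 2) := by positivity
    linarith [min_le_right 1 |x|]
  · have hx2 : 1 ≤ x ^ 2 := by nlinarith
    rw [min_eq_left hx2]
    linarith [min_le_left 1 |x|, norm_nonneg ((Set.Ioo (-1 : ℝ) 0).indicator (fun x => x) x)]

theorem one_sub_exp_le_min {β x : ℝ} (hβ : 0 ≤ β) (hx : x < 0) :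
    |1 - Real.exp (β * x)| ≤ (1 + β) * min 1 |x| := by
  have hbx : β * x ≤ 0 := mul_nonpos_of_nonneg_of_nonpos hβ hx.le
  have he : Real.exp (β * x) ≤ 1 := Real.exp_le_one_iff.2 hbx
  have he0 := Real.exp_pos (β * x)
  have h2 := Real.add_one_le_exp (β * x)
  rw [abs_of_nonneg (by linarith), abs_of_neg hx]
  rcases min_cases 1 (-x) with h | h <;> rw [h.1] <;> nlinarith

theorem IsLevyMeasure.integrable_one_sub_exp (hν : IsLevyMeasure ν) (h0 : ν (Set.Ioi 0) = 0)
    (h : ∫⁻ x in Set.Ioo (-1 : ℝ) 0, ENNReal.ofReal |x| ∂ν ≠ ⊤) {β : ℝ} (hβ : 0 ≤ β) :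
    Integrable (fun x => 1 - Real.exp (β * x)) ν :=
  ((hν.integrable_min_abs h0 h).const_mul (1 + β)).mono' (by fun_prop)
    ((hν.ae_neg h0).mono fun _ hx => one_sub_exp_le_min hβ hx)

theorem IsLevyMeasure.subExponent_nonneg (hν : IsLevyMeasure ν) (h0 : ν (Set.Ioi 0) = 0)
    {β : ℝ} (hβ : 0 ≤ β) : 0 ≤ subExponent ν β :=
  integral_nonneg_of_ae ((hν.ae_neg h0).mono fun x hx => by
    have := Real.exp_le_one_iff.2 (mul_nonpos_of_nonneg_of_nonpos hβ hx.le)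
    simpa using this)

/-- When the small jumps are summable and `σ = 0`, the compensator can be absorbed in the drift. -/
theorem IsLevyMeasure.lapExponent_eq (hν : IsLevyMeasure ν) (h0 : ν (Set.Ioi 0) = 0)
    (h : ∫⁻ x in Set.Ioo (-1 : ℝ) 0, ENNReal.ofReal |x| ∂ν ≠ ⊤) {β : ℝ} (hβ : 0 ≤ β) :
    lapExponent μ 0 ν β = driftCoeff μ ν * β - subExponent ν β := by
  have hi : Integrable ((Set.Ioo (-1 : ℝ) 0).indicator (fun x : ℝ => x)) ν :=
    (IsLevyMeasure.integrableOn_id h).integrable_indicator measurableSet_Ioo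
  have : ∫ x, lapIntegrand β x ∂ν = ∫ x, (-(1 - Real.exp (β * x)) -
      β * (Set.Ioo (-1 : ℝ) 0).indicator (fun x : ℝ => x) x) ∂ν := by
    refine integral_congr_ae ((hν.ae_neg h0).mono fun x hx => ?_)
    simp only [lapIntegrand]
    by_cases hx1 : -1 < x
    · rw [Set.indicator_of_mem (show x ∈ Set.Ioo (-1 : ℝ) 0 from ⟨hx1, hx⟩),
        Set.indicator_of_mem (show x ∈ {y : ℝ | |y| < 1} by
          show |x| < 1; rw [abs_of_neg hx]; linarith)]
      ring
    · rw [Set.indicator_of_notMem (show x ∉ Set.Ioo (-1 : ℝ) 0 from fun h => hx1 h.1),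
        Set.indicator_of_notMem (show x ∉ {y : ℝ | |y| < 1} by
          show ¬ |x| < 1; rw [abs_of_neg hx]; linarith)]
      ring
  have hi' : Integrable (fun x => -(1 - Real.exp (β * x))) ν :=
    (hν.integrable_one_sub_exp h0 h hβ).neg
  rw [lapExponent, this, integral_sub hi' (hi.const_mul _),
    integral_neg, integral_const_mul, integral_indicator measurableSet_Ioo, driftCoeff, subExponent]
  ring

theorem IsLevyMeasure.tendsto_subExponent_div (hν : IsLevyMeasure ν) (h0 : ν (Set.Ioi 0) = 0)
    (h : ∫⁻ x in Set.Ioo (-1 : ℝ) 0, ENNReal.ofReal |x| ∂ν ≠ ⊤) :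
    Tendsto (fun β => subExponent ν β / β) atTop (𝓝 0) := by
  have key : Tendsto (fun β : ℝ => ∫ x, (1 - Real.exp (β * x)) / β ∂ν) atTop
      (𝓝 (∫ _, (0 : ℝ) ∂ν)) := by
    refine tendsto_integral_filter_of_dominated_convergence (fun x => 2 * min 1 |x|)
      (Eventually.of_forall fun β => by fun_prop) ?_
      ((hν.integrable_min_abs h0 h).const_mul 2) ?_
    · filter_upwards [eventually_ge_atTop 1] with β hβ
      filter_upwards [hν.ae_neg h0] with x hx
      have h1 := one_sub_exp_le_min (β := β) (by linarith) hx
      have hm : 0 ≤ min 1 |x| := by positivity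
      rw [norm_div, Real.norm_eq_abs, Real.norm_eq_abs, abs_of_nonneg (show 0 ≤ β by linarith),
        div_le_iff₀ (by linarith)]
      nlinarith
    · filter_upwards [hν.ae_neg h0] with x hx
      refine squeeze_zero_norm' ?_ tendsto_inv_atTop_zero
      filter_upwards [eventually_gt_atTop 0] with β hβ
      have he : Real.exp (β * x) ≤ 1 :=
        Real.exp_le_one_iff.2 (mul_nonpos_of_nonneg_of_nonpos hβ.le hx.le)
      have he0 := Real.exp_pos (β * x)
      rw [norm_div, Real.norm_eq_abs, Real.norm_eq_abs, abs_of_pos hβ,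
        abs_of_nonneg (by linarith), div_eq_mul_inv]
      exact mul_le_of_le_one_left (by positivity) (by linarith)
  simpa [subExponent, integral_div] using key

theorem IsLevyMeasure.tendsto_lapExponent_div (hν : IsLevyMeasure ν) (h0 : ν (Set.Ioi 0) = 0)
    (h : ∫⁻ x in Set.Ioo (-1 : ℝ) 0, ENNReal.ofReal |x| ∂ν ≠ ⊤) :
    Tendsto (fun β => lapExponent μ 0 ν β / β) atTop (𝓝 (driftCoeff μ ν)) := by
  have := (tendsto_const_nhds (x := driftCoeff μ ν)).sub (hν.tendsto_subExponent_div h0 h)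
  rw [sub_zero] at this
  refine this.congr' ?_
  filter_upwards [eventually_gt_atTop 0] with β hβ
  rw [hν.lapExponent_eq h0 h hβ.le]
  field_simp

/-- Jumps smaller than `1 / (n + 1)` contribute nonnegatively, the others at least
`β |x| 1_{x > -1} - 1`. -/
theorem lapIntegrand_lower_bound {β x : ℝ} (hx : x < 0) (n : ℕ) :
    {x : ℝ | 1 / ((n : ℝ) + 1) ≤ |x|}.indicator
      (fun x => β * (Set.Ioo (-1 : ℝ) 0).indicator (fun x => |x|) x - 1) x ≤ lapIntegrand β x := by
  have he0 := Real.exp_pos (β * x)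
  have h2 := Real.add_one_le_exp (β * x)
  unfold lapIntegrand
  by_cases hx1 : -1 < x
  · have hm : x ∈ {y : ℝ | |y| < 1} := by show |x| < 1; rw [abs_of_neg hx]; linarith
    have hm' : x ∈ Set.Ioo (-1 : ℝ) 0 := ⟨hx1, hx⟩
    rw [Set.indicator_of_mem hm]
    by_cases hs : x ∈ {x : ℝ | 1 / ((n : ℝ) + 1) ≤ |x|}
    · rw [Set.indicator_of_mem hs, Set.indicator_of_mem hm', abs_of_neg hx]
      linarith
    · rw [Set.indicator_of_notMem hs]
      linarith
  · have hm : x ∉ {y : ℝ | |y| < 1} := by show ¬ |x| < 1; rw [abs_of_neg hx]; linarith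
    have hm' : x ∉ Set.Ioo (-1 : ℝ) 0 := fun h => hx1 h.1
    have hs : x ∈ {x : ℝ | 1 / ((n : ℝ) + 1) ≤ |x|} := by
      show 1 / ((n : ℝ) + 1) ≤ |x|
      have : 1 / ((n : ℝ) + 1) ≤ 1 := by
        rw [div_le_one (by positivity)]; linarith [(Nat.cast_nonneg n : (0 : ℝ) ≤ n)]
      rw [abs_of_neg hx]; linarith
    rw [Set.indicator_of_notMem hm, Set.indicator_of_mem hs, Set.indicator_of_notMem hm']
    linarith

theorem IsLevyMeasure.lapExponent_lower_bound (hν : IsLevyMeasure ν) (h0 : ν (Set.Ioi 0) = 0)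
    {β : ℝ} (hβ : 0 ≤ β) (n : ℕ) :
    -μ * β + σ ^ 2 / 2 * β ^ 2 +
      (β * (∫ x in {x : ℝ | 1 / ((n : ℝ) + 1) ≤ |x|},
        (Set.Ioo (-1 : ℝ) 0).indicator (fun x => |x|) x ∂ν) -
        ν.real {x : ℝ | 1 / ((n : ℝ) + 1) ≤ |x|}) ≤ lapExponent μ σ ν β := by
  set s := {x : ℝ | 1 / ((n : ℝ) + 1) ≤ |x|} with hs
  have hsm : MeasurableSet s := measurableSet_le measurable_const (by fun_prop)
  have hfin : IsFiniteMeasure (ν.restrict s) :=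
    ⟨by rw [Measure.restrict_apply_univ]; exact hν.measure_le_abs_lt_top Nat.one_div_pos_of_nat⟩
  have hi : Integrable (fun x => (Set.Ioo (-1 : ℝ) 0).indicator (fun x => |x|) x)
      (ν.restrict s) := by
    refine Integrable.of_bound (C := 1)
      ((measurable_id.abs).indicator measurableSet_Ioo).aestronglyMeasurable
      (ae_of_all _ fun x => ?_)
    by_cases hx : x ∈ Set.Ioo (-1 : ℝ) 0
    · rw [Set.indicator_of_mem hx, norm_abs_eq_norm, Real.norm_eq_abs, abs_of_neg hx.2]
      linarith [hx.1]
    · rw [Set.indicator_of_notMem hx]; simp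
  have hi2 : Integrable (fun x => β * (Set.Ioo (-1 : ℝ) 0).indicator (fun x => |x|) x - 1)
      (ν.restrict s) := (hi.const_mul β).sub (integrable_const 1)
  have hmono : ∫ x, s.indicator
      (fun x => β * (Set.Ioo (-1 : ℝ) 0).indicator (fun x => |x|) x - 1) x ∂ν ≤
      ∫ x, lapIntegrand β x ∂ν :=
    integral_mono_ae (IntegrableOn.integrable_indicator hi2 hsm)
      (hν.integrable_lapIntegrand h0 hβ)
      ((hν.ae_neg h0).mono fun x hx => lapIntegrand_lower_bound hx n)
  rw [integral_indicator hsm, integral_sub (hi.const_mul β) (integrable_const 1),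
    integral_const_mul, integral_const] at hmono
  simp only [measureReal_restrict_apply_univ, smul_eq_mul, mul_one] at hmono
  unfold lapExponent
  linarith

/-- With a Gaussian part or with infinite small jump variation, `ψ` grows faster than linearly. -/
theorem IsLevyMeasure.tendsto_lapExponent_div_atTop (hν : IsLevyMeasure ν)
    (h0 : ν (Set.Ioi 0) = 0)
    (h : σ ≠ 0 ∨ ∫⁻ x in Set.Ioo (-1 : ℝ) 0, ENNReal.ofReal |x| ∂ν = ⊤) :
    Tendsto (fun β => lapExponent μ σ ν β / β) atTop atTop := by
  set s : ℕ → Set ℝ := fun n => {x : ℝ | 1 / ((n : ℝ) + 1) ≤ |x|} with hs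
  set M : ℕ → ℝ := fun n => ∫ x in s n, (Set.Ioo (-1 : ℝ) 0).indicator (fun x => |x|) x ∂ν with hM
  have hM0 : ∀ n, 0 ≤ M n := fun n => integral_nonneg fun x =>
    Set.indicator_nonneg (fun x _ => abs_nonneg x) x
  have hlow : ∀ n, ∀ β : ℝ, 1 ≤ β → ν.real (s n) ≤ β →
      -μ + σ ^ 2 / 2 * β + M n - 1 ≤ lapExponent μ σ ν β / β := by
    intro n β hβ hN
    have := hν.lapExponent_lower_bound h0 (μ := μ) (σ := σ) (β := β) (by linarith) n
    rw [le_div_iff₀ (by linarith)]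
    refine le_trans ?_ this
    nlinarith
  rcases h with h | h
  -- Gaussian part: the quadratic term dominates
  · have h1 : Tendsto (fun β : ℝ => -μ + σ ^ 2 / 2 * β + M 0 - 1) atTop atTop := by
      have : Tendsto (fun β : ℝ => σ ^ 2 / 2 * β + (-μ + M 0 - 1)) atTop atTop :=
        tendsto_atTop_add_const_right _ _ (tendsto_id.const_mul_atTop (by positivity))
      refine this.congr fun β => by ring
    refine tendsto_atTop_mono' _ ?_ h1
    filter_upwards [eventually_ge_atTop 1, eventually_ge_atTop (ν.real (s 0))] with β h1 h2
    exact hlow 0 β h1 h2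
  -- infinite variation of the small jumps: `M n` exceeds any bound
  · rw [tendsto_atTop]
    intro K
    have hlim : Tendsto (fun n => ∫⁻ x in s n,
        (Set.Ioo (-1 : ℝ) 0).indicator (fun x => ENNReal.ofReal |x|) x ∂ν) atTop (𝓝 ⊤) := by
      have hmeas : Measurable ((Set.Ioo (-1 : ℝ) 0).indicator (fun x => ENNReal.ofReal |x|)) :=
        Measurable.indicator (by fun_prop) measurableSet_Ioo
      rw [← h, ← lintegral_indicator measurableSet_Ioo]
      have hsm : ∀ n, MeasurableSet (s n) := fun n =>
        measurableSet_le measurable_const (by fun_prop)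
      simp_rw [← lintegral_indicator (hsm _)]
      refine lintegral_tendsto_of_tendsto_of_monotone
        (fun n => (hmeas.indicator (hsm n)).aemeasurable)
        (ae_of_all _ fun x m n hmn => ?_) (ae_of_all _ fun x => ?_)
      · refine Set.indicator_le_indicator_of_subset (fun y hy => ?_) (fun _ => bot_le) x
        exact le_trans (Nat.one_div_le_one_div hmn) (show 1 / ((m : ℝ) + 1) ≤ |y| from hy)
      · rcases eq_or_ne x 0 with rfl | hx
        · simp [Set.indicator]
        · obtain ⟨n, hn⟩ := exists_nat_one_div_lt (abs_pos.2 hx)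
          refine tendsto_const_nhds.congr' ?_
          filter_upwards [eventually_ge_atTop n] with m hm
          rw [Set.indicator_of_mem (show x ∈ s m from (Nat.one_div_le_one_div hm).trans hn.le)]
    obtain ⟨n, hn⟩ := (hlim.eventually (lt_mem_nhds
      (ENNReal.ofReal_lt_top : ENNReal.ofReal (K + μ + 1) < ⊤))).exists
    have hMn : K + μ + 1 ≤ M n := by
      have : ∫⁻ x in s n, (Set.Ioo (-1 : ℝ) 0).indicator (fun x => ENNReal.ofReal |x|) x ∂ν =
          ∫⁻ x in s n, ENNReal.ofReal ((Set.Ioo (-1 : ℝ) 0).indicator (fun x => |x|) x) ∂ν := by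
        refine lintegral_congr fun x => ?_
        by_cases hx : x ∈ Set.Ioo (-1 : ℝ) 0
        · rw [Set.indicator_of_mem hx, Set.indicator_of_mem hx]
        · rw [Set.indicator_of_notMem hx, Set.indicator_of_notMem hx, ENNReal.ofReal_zero]
      by_contra hlt
      rw [this] at hn
      have hMn : ENNReal.ofReal (M n) = _ := ofReal_integral_eq_lintegral_ofReal ?_
        (ae_of_all _ fun x => Set.indicator_nonneg (fun x _ => abs_nonneg x) x)
      · rw [← hMn] at hn
        exact absurd (ENNReal.ofReal_le_ofReal (not_le.1 hlt).le) (not_le.2 hn)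
      · have hfin : IsFiniteMeasure (ν.restrict (s n)) :=
          ⟨by rw [Measure.restrict_apply_univ]
              exact hν.measure_le_abs_lt_top Nat.one_div_pos_of_nat⟩
        refine Integrable.of_bound (C := 1)
          ((measurable_id.abs).indicator measurableSet_Ioo).aestronglyMeasurable
          (ae_of_all _ fun x => ?_)
        by_cases hx : x ∈ Set.Ioo (-1 : ℝ) 0
        · rw [Set.indicator_of_mem hx, norm_abs_eq_norm, Real.norm_eq_abs, abs_of_neg hx.2]
          linarith [hx.1]
        · rw [Set.indicator_of_notMem hx]; simp
    filter_upwards [eventually_ge_atTop 1, eventually_ge_atTop (ν.real (s n))] with β h1 h2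
    have := hlow n β h1 h2
    have : 0 ≤ σ ^ 2 / 2 * β := by positivity
    linarith

end Asymptotics

/-! ### The scale function at zero -/

theorem integral_Ioc_mul_exp_neg (γ : ℝ) :
    ∫ x in Set.Ioc (0 : ℝ) 1, γ * Real.exp (-γ * x) = 1 - Real.exp (-γ) := by
  rw [← intervalIntegral.integral_of_le zero_le_one,
    intervalIntegral.integral_eq_sub_of_hasDerivAt (f := fun x => -Real.exp (-γ * x))
      (fun x _ => ?_) (Continuous.intervalIntegrable (by fun_prop) _ _)]
  · simp; ring
  · have : HasDerivAt (fun x : ℝ => -Real.exp (-γ * x)) (-(Real.exp (-γ * x) * (-γ * 1))) x :=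
      (((hasDerivAt_id x).const_mul (-γ)).exp).neg
    rwa [show γ * Real.exp (-γ * x) = -(Real.exp (-γ * x) * (-γ * 1)) by ring]

/-- Initial value theorem for the Laplace transform. -/
theorem tendsto_mul_integral_exp_neg_mul {g : ℝ → ℝ} (hg : IntegrableOn g (Set.Ioi 0))
    (hc : ContinuousWithinAt g (Set.Ici 0) 0) :
    Tendsto (fun γ : ℝ => γ * ∫ x in Set.Ioi (0 : ℝ), Real.exp (-γ * x) * g x) atTop
      (𝓝 (g 0)) := by
  have hdecay : ∀ η : ℝ, 0 < η → Tendsto (fun γ : ℝ => γ * Real.exp (-γ * η)) atTop (𝓝 0) := by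
    intro η hη
    have h1 := (Real.tendsto_pow_mul_exp_neg_atTop_nhds_zero 1).comp
      (tendsto_id.atTop_mul_const hη)
    have h2 := h1.const_mul η⁻¹
    rw [mul_zero] at h2
    refine h2.congr fun γ => ?_
    simp only [Function.comp, id, pow_one]
    field_simp
  have h := tendsto_setIntegral_peak_smul_of_integrableOn_of_tendsto (μ := volume) (x₀ := (0 : ℝ))
    (l := atTop) (φ := fun γ x : ℝ => γ * Real.exp (-γ * x)) (g := g) (a := g 0)
    measurableSet_Ioi (measurableSet_Ioc (a := (0 : ℝ)) (b := 1)) Set.Ioc_subset_Ioi_self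
    (Ioc_mem_nhdsGT one_pos) (by simp) ?_ ?_ ?_
    (Eventually.of_forall fun γ => Continuous.aestronglyMeasurable (by fun_prop)) hg
    (hc.mono Set.Ioi_subset_Ici_self)
  · refine h.congr fun γ => ?_
    rw [← integral_const_mul]
    simp [mul_assoc]
  · filter_upwards [eventually_ge_atTop 0] with γ hγ x _
    positivity
  · intro u hu h0
    obtain ⟨η, hη, hηu⟩ := Metric.isOpen_iff.1 hu 0 h0
    rw [Metric.tendstoUniformlyOn_iff]
    intro ε hε
    filter_upwards [(hdecay η hη).eventually (gt_mem_nhds hε), eventually_ge_atTop 0]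
      with γ h1 h2 x hx
    have hxpos : 0 < x := hx.1
    have hxη : η ≤ x := by
      by_contra hlt
      exact hx.2 (hηu (by rw [Metric.mem_ball, Real.dist_eq, sub_zero, abs_of_pos hxpos]
                          exact not_le.1 hlt))
    simp only [Pi.zero_apply, dist_zero_left, Real.norm_eq_abs]
    rw [abs_of_nonneg (by positivity)]
    refine lt_of_le_of_lt ?_ h1
    gcongr γ * Real.exp ?_
    nlinarith
  · simp_rw [integral_Ioc_mul_exp_neg]
    have := (Real.tendsto_exp_neg_atTop_nhds_zero).const_sub 1
    simpa using this

/-- The initial value theorem applied to `x ↦ exp (-bx) W(x)`, which is integrable as soon as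
`b > Φ(q)`. -/
theorem IsScaleFunction.tendsto_zero {ψ : ℝ → ℝ} {q : ℝ} {W : ℝ → ℝ} (hW : IsScaleFunction ψ q W) :
    Tendsto (fun β : ℝ => β / (ψ β - q)) atTop (𝓝 (W 0)) := by
  set b := largestRoot ψ q + 1 with hb
  have hc : ContinuousWithinAt (fun x => Real.exp (-b * x) * W x) (Set.Ici 0) 0 :=
    ContinuousWithinAt.mul (by fun_prop) (hW.right_continuous 0 le_rfl)
  have h1 := (tendsto_mul_integral_exp_neg_mul (hW.integrable b (by linarith)) hc).comp
    (tendsto_atTop_add_const_right atTop (-b) tendsto_id)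
  have h2 : Tendsto (fun β : ℝ => β / (β - b)) atTop (𝓝 1) := by
    have h3 : Tendsto (fun β : ℝ => 1 + b / (β - b)) atTop (𝓝 (1 + 0)) :=
      tendsto_const_nhds.add (Tendsto.const_div_atTop
        (tendsto_atTop_add_const_right atTop (-b) tendsto_id) b)
    rw [add_zero] at h3
    refine h3.congr' ?_
    filter_upwards [eventually_gt_atTop b] with β hβ
    have : β - b ≠ 0 := by linarith
    field_simp
    ring
  have h3 := h2.mul h1
  simp only [mul_zero, Real.exp_zero, one_mul] at h3
  refine h3.congr' ?_
  filter_upwards [eventually_gt_atTop b] with β hβ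
  have hne : β - b ≠ 0 := by linarith
  have hint : ∫ x in Set.Ioi (0 : ℝ), Real.exp (-(β + -b) * x) * (Real.exp (-b * x) * W x) =
      1 / (ψ β - q) := by
    rw [← hW.laplace β (by linarith)]
    refine integral_congr_ae (ae_of_all _ fun x => ?_)
    simp only
    rw [← mul_assoc, ← Real.exp_add]
    congr 2
    ring
  simp only [Function.comp, id]
  rw [hint]
  field_simp
  rw [← sub_eq_add_neg]

/-! ### A Fourier criterion for summable jumps -/

theorem min_one_le_two_mul_one_sub_exp {u : ℝ} (hu : 0 ≤ u) :
    min 1 u ≤ 2 * (1 - Real.exp (-u)) := by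
  have h1 : Real.exp (-u) * (1 + u) ≤ 1 := by
    have h2 := Real.add_one_le_exp u
    have h3 : Real.exp (-u) * Real.exp u = 1 := by rw [← Real.exp_add]; simp
    nlinarith [Real.exp_pos (-u)]
  have h4 := Real.exp_pos (-u)
  rcases min_cases 1 u with h | h <;> rw [h.1] <;> nlinarith

/-- The weight `∫_1^∞ (1 - cos (θx)) θ⁻² dθ`, comparable to `1 ∧ |x|`. -/
noncomputable def cosWeight (x : ℝ) : ℝ≥0∞ :=
  ∫⁻ θ in Set.Ioi (1 : ℝ), ENNReal.ofReal ((1 - Real.cos (θ * x)) / θ ^ 2)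

theorem measurable_cosWeight : Measurable cosWeight := by
  unfold cosWeight
  exact Measurable.lintegral_prod_right' (f := fun z : ℝ × ℝ =>
    ENNReal.ofReal ((1 - Real.cos (z.2 * z.1)) / z.2 ^ 2)) (by fun_prop)

theorem one_sub_cos_le (u : ℝ) : 1 - Real.cos u ≤ 4 * u ^ 2 / (4 + u ^ 2) := by
  rw [le_div_iff₀ (by positivity)]
  have h1 := Real.one_sub_sq_div_two_le_cos (x := u)
  have h2 := Real.neg_one_le_cos u
  rcases le_total (u ^ 2) 4 with h | h <;> nlinarith [sq_nonneg u]

theorem cosWeight_le_two (x : ℝ) : cosWeight x ≤ ENNReal.ofReal 2 := by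
  have hi : IntegrableOn (fun θ : ℝ => θ ^ (-2 : ℝ)) (Set.Ioi 1) :=
    integrableOn_Ioi_rpow_of_lt (by norm_num) one_pos
  have hv : ∫ θ : ℝ in Set.Ioi 1, 2 * θ ^ (-2 : ℝ) = 2 := by
    rw [integral_const_mul, integral_Ioi_rpow_of_lt (by norm_num) one_pos]
    norm_num
  rw [← hv, ofReal_integral_eq_lintegral_ofReal (hi.const_mul 2)]
  · refine setLIntegral_mono' measurableSet_Ioi fun θ hθ => ENNReal.ofReal_le_ofReal ?_
    have hθ0 : 0 < θ := lt_trans one_pos hθ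
    rw [Real.rpow_neg hθ0.le, Real.rpow_two, ← div_eq_mul_inv]
    gcongr
    linarith [Real.neg_one_le_cos (θ * x)]
  · filter_upwards [ae_restrict_mem measurableSet_Ioi] with θ hθ
    have hθ0 : (0 : ℝ) < θ := lt_trans one_pos hθ
    positivity

/-- Bounding `1 - cos u` by `4u² / (4 + u²)` turns the weight into a scaled arctangent integral. -/
theorem cosWeight_le_abs (x : ℝ) : cosWeight x ≤ ENNReal.ofReal (8 * |x|) := by
  rcases eq_or_ne x 0 with rfl | hx
  · simp [cosWeight]
  have hi : Integrable (fun θ : ℝ => x ^ 2 * (1 + (x / 2 * θ) ^ 2)⁻¹) :=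
    (integrable_inv_one_add_sq.comp_mul_left' (by simpa using hx)).const_mul _
  have hv : ∫ θ : ℝ, x ^ 2 * (1 + (x / 2 * θ) ^ 2)⁻¹ = 2 * Real.pi * |x| := by
    rw [integral_const_mul, Measure.integral_comp_mul_left (fun y : ℝ => (1 + y ^ 2)⁻¹),
      integral_univ_inv_one_add_sq, ← sq_abs, abs_inv, abs_div, smul_eq_mul]
    have : |x| ≠ 0 := abs_ne_zero.2 hx
    simp
    field_simp
    exact (sq_abs x).symm
  calc cosWeight x ≤ ∫⁻ θ in Set.Ioi (1 : ℝ),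
        ENNReal.ofReal (x ^ 2 * (1 + (x / 2 * θ) ^ 2)⁻¹) := by
        refine setLIntegral_mono' measurableSet_Ioi fun θ hθ => ENNReal.ofReal_le_ofReal ?_
        have hθ0 : 0 < θ := lt_trans one_pos hθ
        rw [div_le_iff₀ (by positivity)]
        refine (one_sub_cos_le _).trans (le_of_eq ?_)
        field_simp
        ring
    _ ≤ ∫⁻ θ : ℝ, ENNReal.ofReal (x ^ 2 * (1 + (x / 2 * θ) ^ 2)⁻¹) :=
        setLIntegral_le_lintegral _ _
    _ = ENNReal.ofReal (2 * Real.pi * |x|) := by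
        rw [← hv, ofReal_integral_eq_lintegral_ofReal hi (ae_of_all _ fun θ => by positivity)]
    _ ≤ ENNReal.ofReal (8 * |x|) := by
        apply ENNReal.ofReal_le_ofReal
        nlinarith [Real.pi_lt_four, abs_nonneg x]

theorem cosWeight_le (x : ℝ) : cosWeight x ≤ ENNReal.ofReal (16 * (1 - Real.exp (-|x|))) := by
  have h : cosWeight x ≤ ENNReal.ofReal (8 * min 1 |x|) := by
    rcases min_cases 1 |x| with h | h <;> rw [h.1]
    · exact (cosWeight_le_two x).trans (ENNReal.ofReal_le_ofReal (by norm_num))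
    · exact cosWeight_le_abs x
  refine h.trans (ENNReal.ofReal_le_ofReal ?_)
  linarith [min_one_le_two_mul_one_sub_exp (abs_nonneg x)]

/-- Only the frequencies `θ ∈ (1/|x|, 2/|x|]`, where `cos (θx)` stays away from `1`, are kept. -/
theorem le_cosWeight {x : ℝ} (hx1 : -1 < x) (hx : x < 0) :
    ENNReal.ofReal |x| ≤ 9 * cosWeight x := by
  have hxp : 0 < |x| := abs_pos.2 hx.ne
  have hx1' : |x| < 1 := by rw [abs_of_neg hx]; linarith
  have h1 : ENNReal.ofReal (|x| / 9) ≤ cosWeight x := by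
    calc ENNReal.ofReal (|x| / 9)
        = ∫⁻ _ in Set.Ioc (1 / |x|) (2 / |x|), ENNReal.ofReal (x ^ 2 / 9) := by
          rw [setLIntegral_const, Real.volume_Ioc, ← ENNReal.ofReal_mul (by positivity), ← sq_abs]
          congr 1
          field_simp
          norm_num
      _ ≤ ∫⁻ θ in Set.Ioc (1 / |x|) (2 / |x|),
          ENNReal.ofReal ((1 - Real.cos (θ * x)) / θ ^ 2) := by
          refine setLIntegral_mono' measurableSet_Ioc fun θ hθ => ENNReal.ofReal_le_ofReal ?_
          have hθ1 : 1 < θ * |x| := (div_lt_iff₀ hxp).1 hθ.1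
          have hθ2 : θ * |x| ≤ 2 := (le_div_iff₀ hxp).1 hθ.2
          have hθ0 : 0 < θ := lt_trans (by positivity) hθ.1
          have hcos : Real.cos (θ * x) ≤ 5 / 9 := by
            rw [← Real.cos_abs, abs_mul, abs_of_pos hθ0]
            refine le_trans ?_ Real.cos_one_le
            exact Real.cos_le_cos_of_nonneg_of_le_pi zero_le_one
              (by linarith [Real.pi_gt_three]) hθ1.le
          rw [le_div_iff₀ (by positivity)]
          have : x ^ 2 * θ ^ 2 ≤ 4 := by
            rw [← sq_abs x]; nlinarith
          nlinarith
      _ ≤ cosWeight x := by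
          refine lintegral_mono_set fun θ hθ => ?_
          refine lt_trans ?_ hθ.1
          rw [lt_div_iff₀ hxp]; linarith
  calc ENNReal.ofReal |x| = 9 * ENNReal.ofReal (|x| / 9) := by
        rw [show (9 : ℝ≥0∞) = ENNReal.ofReal 9 by norm_num, ← ENNReal.ofReal_mul (by norm_num)]
        congr 1; ring
    _ ≤ _ := by gcongr

theorem charIntegrand_re (θ x : ℝ) : (charIntegrand θ x).re = 1 - Real.cos (θ * x) := by
  unfold charIntegrand
  rw [show Complex.I * θ * x = ((θ * x : ℝ) : ℂ) * Complex.I by push_cast; ring]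
  have : (Set.indicator {y : ℝ | |y| < 1} (fun y : ℝ => Complex.I * θ * y) x).re = 0 := by
    by_cases hx : |x| < 1
    · simp [Set.indicator, hx]
    · simp [Set.indicator, hx]
  rw [Complex.add_re, this, Complex.sub_re, Complex.exp_ofReal_mul_I_re]
  simp

theorem IsLevyMeasure.charExponent_re {ν : Measure ℝ} (hν : IsLevyMeasure ν) (μ σ θ : ℝ) :
    (charExponent μ σ ν θ).re = σ ^ 2 / 2 * θ ^ 2 + ∫ x, (1 - Real.cos (θ * x)) ∂ν := by
  have h := integral_re (hν.integrable_charIntegrand θ)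
  simp only [RCLike.re_eq_complex_re, charIntegrand_re] at h
  have h2 : ((σ : ℂ) ^ 2 / 2 * (θ : ℂ) ^ 2) = ((σ ^ 2 / 2 * θ ^ 2 : ℝ) : ℂ) := by push_cast; ring
  rw [charExponent_eq, Complex.add_re, Complex.add_re, ← h, h2, Complex.ofReal_re]
  simp

theorem IsLevyMeasure.integrable_one_sub_cos {ν : Measure ℝ} (hν : IsLevyMeasure ν) (θ : ℝ) :
    Integrable (fun x => 1 - Real.cos (θ * x)) ν := by
  have h := (hν.integrable_charIntegrand θ).re
  simpa only [RCLike.re_eq_complex_re, charIntegrand_re] using h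

theorem tendsto_mul_one_sub_exp (z : ℂ) :
    Tendsto (fun n : ℕ => ((n : ℂ) + 1) * (1 - Complex.exp (-(1 / ((n : ℂ) + 1) * z)))) atTop
      (𝓝 z) := by
  have hd : HasDerivAt (fun w : ℂ => -Complex.exp (-(w * z))) z 0 := by
    have : HasDerivAt (fun w : ℂ => -Complex.exp (-(w * z)))
        (-(Complex.exp (-(0 * z)) * -(1 * z))) 0 :=
      ((((hasDerivAt_id (0 : ℂ)).mul_const z).neg).cexp).neg
    simpa using this
  have hs := hd.tendsto_slope_zero
  have ht : Tendsto (fun n : ℕ => 1 / ((n : ℂ) + 1)) atTop (𝓝[≠] 0) := by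
    refine tendsto_nhdsWithin_iff.2 ⟨tendsto_one_div_add_atTop_nhds_zero_nat, ?_⟩
    exact Eventually.of_forall fun n => one_div_ne_zero (Nat.cast_add_one_ne_zero n)
  refine (hs.comp ht).congr fun n => ?_
  simp only [Function.comp, one_div, inv_inv, zero_add, zero_mul, neg_zero, Complex.exp_zero,
    smul_eq_mul]
  ring

section FourierBound

variable {μ σ : ℝ} {ν : Measure ℝ}

/-- If `n E[1 - exp (-|X_{1/n}|)]` stays bounded then `∫_1^∞ Re Ψ(θ) θ⁻² dθ < ∞`. Indeed
`n (1 - Re E[exp (iθ X_{1/n})])` converges to `Re Ψ(θ)`, and by Tonelli its integral against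
`θ⁻² dθ` is `n E[cosWeight X_{1/n}]`; Fatou's lemma concludes. -/
theorem IsSpectrallyNegativeLevy.lintegral_charExponent_lt_top
    {Ω : Type*} [MeasurableSpace Ω] {P : Measure Ω} [IsProbabilityMeasure P] {X : ℝ≥0 → Ω → ℝ}
    (hX : IsSpectrallyNegativeLevy X P μ σ ν) {K : ℝ≥0∞} (hK : K ≠ ⊤)
    (h : ∀ᶠ n : ℕ in atTop, ∫⁻ ω, ENNReal.ofReal (((n : ℝ) + 1) *
      (1 - Real.exp (-|X (1 / ((n : ℝ≥0) + 1)) ω|))) ∂P ≤ K) :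
    ∫⁻ θ in Set.Ioi (1 : ℝ), ENNReal.ofReal ((charExponent μ σ ν θ).re / θ ^ 2) < ⊤ := by
  set Y : ℕ → Ω → ℝ := fun n => X (1 / ((n : ℝ≥0) + 1)) with hY
  have hYm : ∀ n, Measurable (Y n) := fun n => hX.levy.measurable _
  set F : ℕ → ℝ → ℝ≥0∞ := fun n θ =>
    ∫⁻ ω, ENNReal.ofReal (((n : ℝ) + 1) * ((1 - Real.cos (θ * Y n ω)) / θ ^ 2)) ∂P with hF
  have hjm : ∀ n : ℕ, Measurable (fun z : ℝ × Ω =>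
      ENNReal.ofReal (((n : ℝ) + 1) * ((1 - Real.cos (z.1 * Y n z.2)) / z.1 ^ 2))) := by
    intro n
    have h2 : Measurable (fun z : ℝ × Ω => Y n z.2) := (hYm n).comp measurable_snd
    fun_prop
  have hFm : ∀ n, Measurable (F n) := fun n => (hjm n).lintegral_prod_right'
  have hFlim : ∀ θ, Tendsto (fun n => F n θ) atTop
      (𝓝 (ENNReal.ofReal ((charExponent μ σ ν θ).re / θ ^ 2))) := by
    intro θ
    have hre : ∀ n : ℕ, F n θ = ENNReal.ofReal ((((n : ℂ) + 1) *
        (1 - Complex.exp (-(1 / ((n : ℂ) + 1) * charExponent μ σ ν θ)))).re / θ ^ 2) := by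
      intro n
      have hc := hX.charFun_map (1 / ((n : ℝ≥0) + 1)) θ
      have hcast : (((1 / ((n : ℝ≥0) + 1) : ℝ≥0) : ℝ) : ℂ) = 1 / ((n : ℂ) + 1) := by
        push_cast; ring
      have hbd : Integrable (fun ω => Real.cos (θ * Y n ω)) P :=
        Integrable.of_bound (C := 1) (by fun_prop)
          (ae_of_all _ fun ω => Real.abs_cos_le_one _)
      rw [hcast] at hc
      rw [← hc, charFun_apply_real, integral_map (hYm n).aemeasurable (by fun_prop)]
      have hi : Integrable (fun ω => Complex.exp (θ * (Y n ω : ℝ) * Complex.I)) P := by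
        refine Integrable.of_bound (C := 1) (by fun_prop) (ae_of_all _ fun x => ?_)
        rw [← Complex.ofReal_mul, Complex.norm_exp_ofReal_mul_I]
      have hir := integral_re hi
      simp only [RCLike.re_eq_complex_re, ← Complex.ofReal_mul, Complex.exp_ofReal_mul_I_re] at hir
      have hfin : (((n : ℂ) + 1) * (1 - ∫ ω, Complex.exp (θ * (Y n ω : ℝ) * Complex.I) ∂P)).re /
          θ ^ 2 = ∫ ω, ((n : ℝ) + 1) * ((1 - Real.cos (θ * Y n ω)) / θ ^ 2) ∂P := by
        rw [integral_const_mul, integral_div, integral_sub (integrable_const 1) hbd, hir,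
          show ((n : ℂ) + 1) = (((n : ℝ) + 1 : ℝ) : ℂ) by push_cast; ring, Complex.re_ofReal_mul,
          Complex.sub_re]
        simp only [Complex.ofReal_mul, integral_const, probReal_univ, smul_eq_mul, mul_one,
          Complex.one_re]
        ring
      rw [hfin, ofReal_integral_eq_lintegral_ofReal]
      · exact (((integrable_const 1).sub hbd).div_const _).const_mul _
      · refine ae_of_all _ fun ω => ?_
        have := Real.cos_le_one (θ * Y n ω)
        have : 0 ≤ 1 - Real.cos (θ * Y n ω) := by linarith
        simp only [Pi.zero_apply]
        positivity
    simp_rw [hre]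
    refine (ENNReal.continuous_ofReal.tendsto _).comp (Tendsto.div_const ?_ _)
    exact (Complex.continuous_re.tendsto _).comp (tendsto_mul_one_sub_exp _)
  have hFint : ∀ n : ℕ, ∫⁻ θ in Set.Ioi (1 : ℝ), F n θ ≤ 16 * ∫⁻ ω, ENNReal.ofReal (((n : ℝ) + 1) *
      (1 - Real.exp (-|Y n ω|))) ∂P := by
    intro n
    simp only [hF]
    rw [lintegral_lintegral_swap (hjm n).aemeasurable, ← lintegral_const_mul _ (by fun_prop)]
    refine lintegral_mono fun ω => ?_
    have : ∫⁻ θ in Set.Ioi (1 : ℝ),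
        ENNReal.ofReal (((n : ℝ) + 1) * ((1 - Real.cos (θ * Y n ω)) / θ ^ 2)) =
        ENNReal.ofReal ((n : ℝ) + 1) * cosWeight (Y n ω) := by
      rw [cosWeight, ← lintegral_const_mul _ (by fun_prop)]
      refine lintegral_congr fun θ => ?_
      rw [ENNReal.ofReal_mul (by positivity)]
    rw [this]
    refine (mul_le_mul_right (cosWeight_le (Y n ω)) _).trans (le_of_eq ?_)
    rw [show (16 : ℝ≥0∞) = ENNReal.ofReal 16 by norm_num, ← ENNReal.ofReal_mul (by positivity),
      ← ENNReal.ofReal_mul (by positivity)]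
    congr 1; ring
  calc ∫⁻ θ in Set.Ioi (1 : ℝ), ENNReal.ofReal ((charExponent μ σ ν θ).re / θ ^ 2)
      = ∫⁻ θ in Set.Ioi (1 : ℝ), liminf (fun n => F n θ) atTop :=
        lintegral_congr fun θ => (hFlim θ).liminf_eq.symm
    _ ≤ liminf (fun n => ∫⁻ θ in Set.Ioi (1 : ℝ), F n θ) atTop := lintegral_liminf_le hFm
    _ ≤ 16 * K := by
        refine liminf_le_of_frequently_le' (Eventually.frequently ?_)
        filter_upwards [h] with n hn
        exact (hFint n).trans (mul_le_mul_right hn _)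
    _ < ⊤ := ENNReal.mul_lt_top (by norm_num) (lt_top_iff_ne_top.2 hK)

/-- `Re Ψ(θ) ≥ σ² θ² / 2`, so a Gaussian part makes the integral diverge. -/
theorem IsLevyMeasure.sigma_eq_zero (hν : IsLevyMeasure ν)
    (h : ∫⁻ θ in Set.Ioi (1 : ℝ), ENNReal.ofReal ((charExponent μ σ ν θ).re / θ ^ 2) < ⊤) :
    σ = 0 := by
  by_contra hσ
  have hle : ∫⁻ _ in Set.Ioi (1 : ℝ), ENNReal.ofReal (σ ^ 2 / 2) ≤
      ∫⁻ θ in Set.Ioi (1 : ℝ), ENNReal.ofReal ((charExponent μ σ ν θ).re / θ ^ 2) := by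
    refine setLIntegral_mono' measurableSet_Ioi fun θ hθ => ENNReal.ofReal_le_ofReal ?_
    have hθ0 : 0 < θ := lt_trans one_pos hθ
    rw [hν.charExponent_re, le_div_iff₀ (by positivity)]
    have : 0 ≤ ∫ x, (1 - Real.cos (θ * x)) ∂ν :=
      integral_nonneg fun x => sub_nonneg.2 (Real.cos_le_one _)
    linarith
  rw [setLIntegral_const, Real.volume_Ioi, ENNReal.mul_top] at hle
  · exact absurd (hle.trans_lt h) (lt_irrefl _)
  · have : 0 < σ ^ 2 / 2 := by positivity
    simpa using this

/-- By Tonelli, `∫ cosWeight dν ≤ ∫_1^∞ Re Ψ(θ) θ⁻² dθ`, and `cosWeight x` dominates `|x|` for small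
jumps. -/
theorem IsLevyMeasure.lintegral_abs_ne_top (hν : IsLevyMeasure ν)
    (h : ∫⁻ θ in Set.Ioi (1 : ℝ), ENNReal.ofReal ((charExponent μ σ ν θ).re / θ ^ 2) < ⊤) :
    ∫⁻ x in Set.Ioo (-1 : ℝ) 0, ENNReal.ofReal |x| ∂ν ≠ ⊤ := by
  have hsf := hν.sigmaFinite
  have hg : ∫⁻ x, cosWeight x ∂ν ≤
      ∫⁻ θ in Set.Ioi (1 : ℝ), ENNReal.ofReal ((charExponent μ σ ν θ).re / θ ^ 2) := by
    unfold cosWeight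
    rw [lintegral_lintegral_swap (by fun_prop)]
    refine setLIntegral_mono' measurableSet_Ioi fun θ hθ => ?_
    have hθ0 : 0 < θ := lt_trans one_pos hθ
    have h0 : ∀ x, 0 ≤ 1 - Real.cos (θ * x) := fun x => sub_nonneg.2 (Real.cos_le_one _)
    rw [← ofReal_integral_eq_lintegral_ofReal ((hν.integrable_one_sub_cos θ).div_const _)
      (ae_of_all _ fun x => div_nonneg (h0 x) (sq_nonneg _)), integral_div]
    refine ENNReal.ofReal_le_ofReal ?_
    rw [hν.charExponent_re]
    gcongr
    have : 0 ≤ σ ^ 2 / 2 * θ ^ 2 := by positivity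
    linarith
  have hle : ∫⁻ x in Set.Ioo (-1 : ℝ) 0, ENNReal.ofReal |x| ∂ν ≤ 9 * ∫⁻ x, cosWeight x ∂ν := by
    rw [← lintegral_const_mul _ measurable_cosWeight]
    exact (setLIntegral_mono' measurableSet_Ioo fun x hx => le_cosWeight hx.1 hx.2).trans
      (setLIntegral_le_lintegral _ _)
  exact (hle.trans_lt (ENNReal.mul_lt_top (by norm_num) (hg.trans_lt h))).ne

end FourierBound

/-! ### Consequences of bounded variation -/

section Increments

variable {Ω : Type*} [MeasurableSpace Ω] {P : Measure Ω} {X : ℝ≥0 → Ω → ℝ}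

theorem IsLevyProcess.lintegral_increment (hX : IsLevyProcess X P) (h : ℝ≥0)
    {f : ℝ → ℝ≥0∞} (hf : Measurable f) (i : ℕ) :
    ∫⁻ ω, f (X ((i + 1 : ℕ) * h) ω - X (i * h) ω) ∂P = ∫⁻ ω, f (X h ω) ∂P := by
  have hst := (hX.stationary (i * h) h).comp hf
  rw [show ((i : ℝ≥0) * h + h) = ((i + 1 : ℕ) : ℝ≥0) * h by push_cast; ring] at hst
  exact hst.lintegral_eq

/-- For a Lévy process, the expectation of a product of functions of successive increments over an
equidistant grid. -/
theorem IsLevyProcess.lintegral_prod_increments (hX : IsLevyProcess X P) (h : ℝ≥0)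
    {f : ℝ → ℝ≥0∞} (hf : Measurable f) (n : ℕ) :
    ∫⁻ ω, ∏ i ∈ Finset.range n, f (X ((i + 1 : ℕ) * h) ω - X (i * h) ω) ∂P =
      (∫⁻ ω, f (X h ω) ∂P) ^ n := by
  have hmono : Monotone (fun i : ℕ => (i : ℝ≥0) * h) := fun i j hij => by
    dsimp only; gcongr
  have hind := (hX.indep_increments.nat hmono).comp (fun _ => f) (fun _ => hf)
  have hmeas : ∀ i : ℕ, Measurable
      (f ∘ fun ω => X ((i + 1 : ℕ) * h) ω - X (i * h) ω) := fun i =>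
    hf.comp ((hX.measurable _).sub (hX.measurable _))
  rw [show (∫⁻ ω, f (X h ω) ∂P) ^ n = ∏ _i ∈ Finset.range n, ∫⁻ ω, f (X h ω) ∂P by simp]
  refine (lintegral_prod_eq_prod_lintegral_of_indepFun (Finset.range n) _ hind hmeas).trans ?_
  exact Finset.prod_congr rfl fun i _ => hX.lintegral_increment h hf i

/-- If a Lévy process has paths of bounded variation, then `n E[1 - exp (-|X_{1/n}|)]` stays
bounded: otherwise `E[exp (-V)]` would vanish, where `V` is the variation on `[0, 1]`. -/
theorem IsLevyProcess.exists_bound_of_boundedVariation [IsProbabilityMeasure P]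
    (hX : IsLevyProcess X P) (hbv : HasPathsOfBoundedVariation X P) :
    ∃ K : ℝ≥0∞, K ≠ ⊤ ∧ ∀ᶠ n : ℕ in atTop, ∫⁻ ω, ENNReal.ofReal (((n : ℝ) + 1) *
      (1 - Real.exp (-|X (1 / ((n : ℝ≥0) + 1)) ω|))) ∂P ≤ K := by
  set h : ℕ → ℝ≥0 := fun n => 1 / ((n : ℝ≥0) + 1) with hh
  set Z : ℕ → Ω → ℝ≥0∞ := fun n ω => ∏ i ∈ Finset.range (n + 1),
    ENNReal.ofReal (Real.exp (-|X ((i + 1 : ℕ) * h n) ω - X (i * h n) ω|)) with hZ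
  set b : ℕ → ℝ := fun n => ∫ ω, Real.exp (-|X (h n) ω|) ∂P with hb
  have hint : ∀ n, Integrable (fun ω => Real.exp (-|X (h n) ω|)) P := by
    intro n
    have := hX.measurable (h n)
    refine Integrable.of_bound (C := 1) (by fun_prop) (ae_of_all _ fun ω => ?_)
    rw [Real.norm_eq_abs, abs_of_pos (Real.exp_pos _), Real.exp_le_one_iff]
    simp
  have hb0 : ∀ n, 0 ≤ b n := fun n => integral_nonneg fun ω => (Real.exp_pos _).le
  have hZm : ∀ n, Measurable (Z n) := by
    intro n
    refine Finset.measurable_prod _ fun i _ => ?_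
    have h1 := hX.measurable ((i + 1 : ℕ) * h n)
    have h2 := hX.measurable (i * h n)
    fun_prop
  have hZint : ∀ n, ∫⁻ ω, Z n ω ∂P = ENNReal.ofReal (b n ^ (n + 1)) := by
    intro n
    have := hX.lintegral_prod_increments (h n)
      (f := fun x => ENNReal.ofReal (Real.exp (-|x|))) (by fun_prop) (n + 1)
    refine this.trans ?_
    rw [← ofReal_integral_eq_lintegral_ofReal (hint n)
      (ae_of_all _ fun ω => (Real.exp_pos _).le), ENNReal.ofReal_pow (hb0 n)]
  -- almost surely `Z n` is bounded below by `exp (-V)`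
  have hpos : ∀ᵐ ω ∂P, 0 < liminf (fun n => Z n ω) atTop := by
    filter_upwards [hbv] with ω hω
    have hV := hω 0 1 trivial trivial
    rw [Set.univ_inter] at hV
    set V := eVariationOn (fun t => X t ω) (Set.Icc 0 1) with hVdef
    have hVt : V ≠ ⊤ := hV
    refine lt_of_lt_of_le (ENNReal.ofReal_pos.2 (Real.exp_pos (-V.toReal)))
      (le_liminf_of_le (h := Eventually.of_forall fun n => ?_))
    have hsum : ∑ i ∈ Finset.Ico 0 (n + 1),
        edist (X ((i + 1 : ℕ) * h n) ω) (X (i * h n) ω) ≤ V := by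
      refine eVariationOn.sum_le_of_monotoneOn_Icc (f := fun t => X t ω)
        (u := fun i : ℕ => (i : ℝ≥0) * h n) (fun i _ j _ hij => by dsimp only; gcongr)
        (fun i hi => ⟨bot_le, ?_⟩)
      have h1 : (i : ℝ≥0) ≤ (n : ℝ≥0) + 1 := by exact_mod_cast hi.2
      simp only [hh, mul_one_div]
      exact div_le_one_of_le₀ h1 bot_le
    rw [← Finset.range_eq_Ico] at hsum
    have hsum' : ∑ i ∈ Finset.range (n + 1), |X ((i + 1 : ℕ) * h n) ω - X (i * h n) ω| ≤
        V.toReal := by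
      rw [← ENNReal.ofReal_le_iff_le_toReal hVt,
        ENNReal.ofReal_sum_of_nonneg fun i _ => abs_nonneg _]
      simpa only [edist_dist, Real.dist_eq] using hsum
    simp only [hZ]
    rw [← ENNReal.ofReal_prod_of_nonneg fun i _ => (Real.exp_pos _).le, ← Real.exp_sum,
      Finset.sum_neg_distrib]
    exact ENNReal.ofReal_le_ofReal (Real.exp_le_exp.2 (neg_le_neg hsum'))
  have hlim : 0 < liminf (fun n => ENNReal.ofReal (b n ^ (n + 1))) atTop := by
    have h1 : 0 < ∫⁻ ω, liminf (fun n => Z n ω) atTop ∂P := by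
      rw [pos_iff_ne_zero, Ne, lintegral_eq_zero_iff (Measurable.liminf hZm)]
      intro h0
      obtain ⟨ω, h2, h3⟩ := (h0.and hpos).exists
      exact h3.ne' h2
    refine h1.trans_le ((lintegral_liminf_le hZm).trans (le_of_eq ?_))
    simp_rw [hZint]
  obtain ⟨c, hc0, hc⟩ := exists_between hlim
  have hev := eventually_lt_of_lt_liminf hc
  have hctop : c ≠ ⊤ := (lt_top_of_lt hc).ne
  have hcr : 0 < c.toReal := ENNReal.toReal_pos hc0.ne' hctop
  refine ⟨ENNReal.ofReal (-Real.log c.toReal), ENNReal.ofReal_ne_top, ?_⟩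
  filter_upwards [hev] with n hn
  have hcb : c.toReal ≤ b n ^ (n + 1) := ENNReal.toReal_le_of_le_ofReal
    (pow_nonneg (hb0 n) _) hn.le
  have hI : Integrable (fun ω => ((n : ℝ) + 1) *
      (1 - Real.exp (-|X (1 / ((n : ℝ≥0) + 1)) ω|))) P :=
    ((integrable_const 1).sub (hint n)).const_mul _
  rw [← ofReal_integral_eq_lintegral_ofReal hI
    (ae_of_all _ fun ω => mul_nonneg (by positivity)
      (sub_nonneg.2 (Real.exp_le_one_iff.2 (by simp)))), integral_const_mul]
  have hsub : ∫ ω, ((1 : ℝ) - Real.exp (-|X (h n) ω|)) ∂P = 1 - b n := by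
    rw [integral_sub (integrable_const 1) (hint n)]; simp [hb]
  refine ENNReal.ofReal_le_ofReal ?_
  refine (congrArg (fun y => ((n : ℝ) + 1) * y) hsub).le.trans ?_
  have hbe : b n ≤ Real.exp (-(1 - b n)) := by
    have := Real.add_one_le_exp (-(1 - b n)); linarith
  have hle : c.toReal ≤ Real.exp (((n : ℝ) + 1) * (-(1 - b n))) := by
    refine hcb.trans ((pow_le_pow_left₀ (hb0 n) hbe _).trans (le_of_eq ?_))
    rw [← Real.exp_nat_mul]; push_cast; rfl
  have := (Real.log_le_iff_le_exp hcr).2 hle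
  linarith

end Increments

/-- A spectrally negative Lévy process of bounded variation has no Gaussian part and its small
jumps are summable. -/
theorem IsSpectrallyNegativeLevy.of_boundedVariation {Ω : Type*} [MeasurableSpace Ω]
    {P : Measure Ω} [IsProbabilityMeasure P] {X : ℝ≥0 → Ω → ℝ} {μ σ : ℝ} {ν : Measure ℝ}
    (hX : IsSpectrallyNegativeLevy X P μ σ ν) (hbv : HasPathsOfBoundedVariation X P) :
    σ = 0 ∧ ∫⁻ x in Set.Ioo (-1 : ℝ) 0, ENNReal.ofReal |x| ∂ν ≠ ⊤ := by
  obtain ⟨K, hK, h⟩ := hX.levy.exists_bound_of_boundedVariation hbv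
  have h2 := hX.lintegral_charExponent_lt_top hK h
  exact ⟨hX.isLevyMeasure.sigma_eq_zero h2, hX.isLevyMeasure.lintegral_abs_ne_top h2⟩

/-! ### Monotone paths and their jumps -/

theorem eVariationOn_sub_le {α : Type*} [LinearOrder α] (f g : α → ℝ) (s : Set α) :
    eVariationOn (fun x => f x - g x) s ≤ eVariationOn f s + eVariationOn g s := by
  refine iSup_le fun p => ?_
  refine (Finset.sum_le_sum fun i _ => ?_).trans ((Finset.sum_add_distrib).le.trans (add_le_add
    (eVariationOn.sum_le p.2.2.1 p.2.2.2) (eVariationOn.sum_le p.2.2.1 p.2.2.2)))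
  simp only [edist_dist, ← ENNReal.ofReal_add dist_nonneg dist_nonneg]
  exact ENNReal.ofReal_le_ofReal (dist_sub_sub_le _ _ _ _)

theorem locallyBoundedVariationOn_sub {α : Type*} [LinearOrder α] {f g : α → ℝ} {s : Set α}
    (hf : LocallyBoundedVariationOn f s) (hg : LocallyBoundedVariationOn g s) :
    LocallyBoundedVariationOn (fun x => f x - g x) s := fun a b ha hb =>
  ((eVariationOn_sub_le f g _).trans_lt
    (ENNReal.add_lt_top.2 ⟨(hf a b ha hb).lt_top, (hg a b ha hb).lt_top⟩)).ne

/-- A right-continuous function on `ℝ≥0` which is monotone along a dense set is monotone. -/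
theorem monotone_of_dense {f : ℝ≥0 → ℝ} {D : Set ℝ≥0} (hD : Dense D)
    (hc : ∀ t, ContinuousWithinAt f (Set.Ici t) t)
    (hm : ∀ a ∈ D, ∀ b ∈ D, a ≤ b → f a ≤ f b) : Monotone f := by
  have hlim : ∀ t, Tendsto f (𝓝[>] t) (𝓝 (f t)) := fun t =>
    (hc t).mono Set.Ioi_subset_Ici_self
  have hfreq : ∀ t u : ℝ≥0, t < u → ∃ᶠ e in 𝓝[>] t, e ∈ D ∧ e < u := by
    intro t u htu
    rw [frequently_iff]
    intro U hU
    obtain ⟨v, hv, hvU⟩ := mem_nhdsGT_iff_exists_Ioo_subset.1 hU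
    obtain ⟨e, he, h1, h2⟩ := hD.exists_between (lt_min hv htu)
    exact ⟨e, hvU ⟨h1, h2.trans_le (min_le_left _ _)⟩, he, h2.trans_le (min_le_right _ _)⟩
  have h1 : ∀ a ∈ D, ∀ b, a ≤ b → f a ≤ f b := by
    intro a ha b hab
    refine ge_of_tendsto_of_frequently (hlim b) ?_
    refine ((hfreq b (b + 1) (by simp)).and_eventually self_mem_nhdsWithin).mono ?_
    rintro e ⟨⟨he, _⟩, hbe⟩
    exact hm a ha e he (hab.trans hbe.le)
  intro a b hab
  rcases hab.eq_or_lt with rfl | hab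
  · exact le_rfl
  · refine le_of_tendsto_of_frequently (hlim a) ((hfreq a b hab).mono ?_)
    rintro e ⟨he, heb⟩
    exact h1 e he b heb.le

section Jumps

theorem StieltjesFunction.countable_atoms (f : StieltjesFunction ℝ≥0) :
    {x | f.measure {x} ≠ 0}.Countable := by
  have := Measure.countable_meas_pos_of_disjoint_iUnion (μ := f.measure)
    (As := fun x : ℝ≥0 => {x}) (fun x => measurableSet_singleton x)
    (fun x y hxy => Set.disjoint_singleton.2 hxy)
  simpa [pos_iff_ne_zero] using this

/-- The diffuse part of the mass of a monotone function on an interval is bounded by the sums of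
its truncated increments over fine grids. -/
theorem StieltjesFunction.measure_diff_atoms_le (f : StieltjesFunction ℝ≥0) (N : ℕ) {ε : ℝ}
    (hε : 0 < ε) :
    f.measure (Set.Ioc 0 (N : ℝ≥0) \ {x | f.measure {x} ≠ 0}) ≤
      liminf (fun n : ℕ => ∑ i ∈ Finset.range (n + 1), ENNReal.ofReal
        (min ε (f ((i + 1 : ℕ) * ((N : ℝ≥0) / (n + 1))) - f (i * ((N : ℝ≥0) / (n + 1)))))) atTop := by
  set h : ℕ → ℝ≥0 := fun n => (N : ℝ≥0) / (n + 1) with hh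
  set cell : ℕ → ℕ → Set ℝ≥0 := fun n i => Set.Ioc (i * h n) ((i + 1 : ℕ) * h n) with hcell
  -- `B n` is the union of the cells over which `f` increases by at most `ε`
  set G : ℕ → Finset ℕ := fun n => (Finset.range (n + 1)).filter
    (fun i => f ((i + 1 : ℕ) * h n) - f (i * h n) ≤ ε) with hG
  set B : ℕ → Set ℝ≥0 := fun n => ⋃ i ∈ G n, cell n i with hB
  have hBm : ∀ n, MeasurableSet (B n) := fun n =>
    Finset.measurableSet_biUnion _ fun i _ => measurableSet_Ioc
  set T := Set.Ioc 0 (N : ℝ≥0) \ {x | f.measure {x} ≠ 0} with hT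
  have hTm : MeasurableSet T := measurableSet_Ioc.diff f.countable_atoms.measurableSet
  have hBle : ∀ n, f.measure (B n) ≤ ∑ i ∈ Finset.range (n + 1),
      ENNReal.ofReal (min ε (f ((i + 1 : ℕ) * h n) - f (i * h n))) := by
    intro n
    refine (measure_biUnion_finset_le _ _).trans ?_
    refine (Finset.sum_le_sum fun i hi => ?_).trans
      (Finset.sum_le_sum_of_subset (Finset.filter_subset _ _))
    rw [hcell, StieltjesFunction.measure_Ioc, min_eq_right (Finset.mem_filter.1 hi).2]
  -- a point carrying no atom eventually lies in cells with small increments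
  have hmem : ∀ x ∈ T, ∀ᶠ n in atTop, x ∈ B n := by
    intro x hx
    have hx0 : 0 < x := hx.1.1
    have hxN : x ≤ N := hx.1.2
    have hatom : f.measure {x} = 0 := not_not.1 hx.2
    rw [StieltjesFunction.measure_singleton, ENNReal.ofReal_eq_zero, sub_nonpos] at hatom
    have hl := f.mono.tendsto_leftLim x
    have hr : Tendsto f (𝓝[≥] x) (𝓝 (f x)) := f.right_continuous x
    obtain ⟨y, hy, hy'⟩ : ∃ y < x, ∀ z ∈ Set.Ioo y x, f x - ε / 2 < f z := by
      have h1 : ∀ᶠ z in 𝓝[<] x, f x - ε / 2 < f z :=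
        hl.eventually (lt_mem_nhds (by linarith))
      obtain ⟨y, hy, hy'⟩ := (mem_nhdsLT_iff_exists_Ioo_subset' hx0).1 h1
      exact ⟨y, hy, hy'⟩
    obtain ⟨w, hw, hw'⟩ : ∃ w > x, ∀ z ∈ Set.Ico x w, f z < f x + ε / 2 := by
      have h1 : ∀ᶠ z in 𝓝[≥] x, f z < f x + ε / 2 :=
        hr.eventually (gt_mem_nhds (by linarith))
      obtain ⟨w, hw, hw'⟩ := mem_nhdsGE_iff_exists_Ico_subset.1 h1
      exact ⟨w, hw, hw'⟩
    have hlim : Tendsto h atTop (𝓝 0) := by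
      have := (tendsto_const_div_atTop_nhds_zero_nat (N : ℝ≥0)).comp (tendsto_add_atTop_nat 1)
      refine this.congr fun n => ?_
      simp [hh]
    have hev := hlim.eventually (gt_mem_nhds
      (lt_min (tsub_pos_of_lt hy) (tsub_pos_of_lt hw) : 0 < min (x - y) (w - x)))
    filter_upwards [hev] with n hn
    have hN0 : (0 : ℝ≥0) < N := hx0.trans_le hxN
    have hn0 : 0 < h n := by positivity
    have hny : y + h n < x := by
      have := hn.trans_le (min_le_left _ _)
      rw [lt_tsub_iff_left] at this
      exact this
    have hnw : x + h n < w := by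
      have := hn.trans_le (min_le_right _ _)
      rw [lt_tsub_iff_left] at this
      exact this
    -- the cell containing `x`
    obtain ⟨i, hi⟩ : ∃ i : ℕ, ⌈x / h n⌉₊ = i + 1 :=
      Nat.exists_eq_succ_of_ne_zero (Nat.ceil_pos.2 (by positivity)).ne'
    have hi1 : (i : ℝ≥0) * h n < x := by
      have : (i : ℝ≥0) < x / h n := Nat.lt_ceil.1 (by omega)
      exact (lt_div_iff₀ hn0).1 this
    have hi2 : x ≤ ((i + 1 : ℕ) : ℝ≥0) * h n := by
      rw [← hi]; exact (div_le_iff₀ hn0).1 (Nat.le_ceil _)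
    have hi3 : ((i + 1 : ℕ) : ℝ≥0) * h n = i * h n + h n := by push_cast; ring
    have hin : i < n + 1 := by
      have h1 : ⌈x / h n⌉₊ ≤ n + 1 := by
        rw [Nat.ceil_le, div_le_iff₀ hn0]
        refine hxN.trans (le_of_eq ?_)
        simp only [hh]; push_cast; field_simp
      omega
    have hyl : y < i * h n := by
      have : y + h n < i * h n + h n := hny.trans_le (hi2.trans hi3.le)
      exact lt_of_add_lt_add_right this
    have hfl := hy' _ ⟨hyl, hi1⟩
    have hfr := hw' (((i + 1 : ℕ) : ℝ≥0) * h n) ⟨hi2, by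
      rw [hi3]; exact (add_lt_add_left hi1 _).trans hnw⟩
    refine Set.mem_biUnion (Finset.mem_coe.2 (Finset.mem_filter.2
      ⟨Finset.mem_range.2 hin, ?_⟩)) (show x ∈ cell n i from ⟨hi1, hi2⟩)
    linarith
  calc f.measure T = ∫⁻ x, T.indicator 1 x ∂f.measure := (lintegral_indicator_one hTm).symm
    _ ≤ ∫⁻ x, liminf (fun n => (B n).indicator (1 : ℝ≥0 → ℝ≥0∞) x) atTop ∂f.measure := by
        refine lintegral_mono fun x => ?_
        by_cases hx : x ∈ T
        · rw [Set.indicator_of_mem hx]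
          refine le_liminf_of_le (h := ?_)
          filter_upwards [hmem x hx] with n hn
          rw [Set.indicator_of_mem hn]
        · rw [Set.indicator_of_notMem hx]; exact bot_le
    _ ≤ liminf (fun n => ∫⁻ x, (B n).indicator (1 : ℝ≥0 → ℝ≥0∞) x ∂f.measure) atTop :=
        lintegral_liminf_le fun n => measurable_one.indicator (hBm n)
    _ ≤ _ := by
        refine liminf_le_liminf (Eventually.of_forall fun n => ?_)
        rw [lintegral_indicator_one (hBm n)]
        exact hBle n

/-- A monotone right-continuous function whose Stieltjes measure is purely atomic is the sum of
its jumps. The point `0` carries no mass, because the left limit of a function at `0 : ℝ≥0` is by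
convention its value there. -/
theorem StieltjesFunction.hasSum_jumps (f : StieltjesFunction ℝ≥0) (h0 : f 0 = 0)
    (h : ∀ N : ℕ, f.measure (Set.Ioc 0 (N : ℝ≥0) \ {x | f.measure {x} ≠ 0}) = 0) (t : ℝ≥0) :
    HasSum (fun s : Set.Iic t => f s - Function.leftLim f (s : ℝ≥0)) (f t) := by
  set A := {x | f.measure {x} ≠ 0} with hA
  have hzero : f.measure {0} = 0 := by
    rw [StieltjesFunction.measure_singleton, leftLim_eq_of_eq_bot, sub_self, ENNReal.ofReal_zero]
    exact nhdsLT_eq_bot_iff.2 (Or.inl isBot_bot)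
  have hft : 0 ≤ f t := h0 ▸ f.mono bot_le
  have h1 : f.measure (Set.Ioc 0 t ∩ A) = ENNReal.ofReal (f t) := by
    obtain ⟨N, hN⟩ := exists_nat_ge t
    have hnull : f.measure (Set.Ioc 0 t \ A) = 0 :=
      measure_mono_null (Set.sdiff_subset_sdiff_left (Set.Ioc_subset_Ioc_right hN)) (h N)
    have := measure_inter_add_sdiff (μ := f.measure) (Set.Ioc 0 t) f.countable_atoms.measurableSet
    rw [← hA, hnull, add_zero, StieltjesFunction.measure_Ioc, h0, sub_zero] at this
    exact this
  have h2 : ∑' s : Set.Iic t, f.measure {(s : ℝ≥0)} = ENNReal.ofReal (f t) := by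
    rw [← h1]
    have hc : (Set.Ioc 0 t ∩ A).Countable := f.countable_atoms.mono Set.inter_subset_right
    have h3 := measure_biUnion (μ := f.measure) (f := fun x : ℝ≥0 => {x}) hc
      (fun x _ y _ hxy => Set.disjoint_singleton.2 hxy) (fun x _ => measurableSet_singleton x)
    rw [Set.biUnion_of_singleton] at h3
    rw [h3, tsum_subtype (Set.Iic t) (fun x => f.measure {x}),
      tsum_subtype (Set.Ioc 0 t ∩ A) (fun x => f.measure {x})]
    refine tsum_congr fun x => ?_
    by_cases hx : x ∈ Set.Ioc 0 t ∩ A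
    · rw [Set.indicator_of_mem hx, Set.indicator_of_mem (show x ∈ Set.Iic t from hx.1.2)]
    · rw [Set.indicator_of_notMem hx]
      by_cases hxt : x ∈ Set.Iic t
      · rw [Set.indicator_of_mem hxt]
        by_contra hne
        refine hx ⟨⟨pos_iff_ne_zero.2 ?_, hxt⟩, hne⟩
        rintro rfl
        exact hne hzero
      · rw [Set.indicator_of_notMem hxt]
  have h4 := ENNReal.hasSum_toReal (f := fun s : Set.Iic t => f.measure {(s : ℝ≥0)})
    (by rw [h2]; exact ENNReal.ofReal_ne_top)
  rw [← ENNReal.tsum_toReal_eq (fun s => by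
    rw [StieltjesFunction.measure_singleton]; exact ENNReal.ofReal_ne_top), h2,
    ENNReal.toReal_ofReal hft] at h4
  convert h4 using 2 with s
  rw [StieltjesFunction.measure_singleton, ENNReal.toReal_ofReal]
  exact sub_nonneg.2 (f.mono.leftLim_le le_rfl)

end Jumps

/-! ### Decomposition into drift and subordinator -/

section Drift

variable {Ω : Type*} [MeasurableSpace Ω] {P : Measure Ω}
  {X S : ℝ≥0 → Ω → ℝ} {μ : ℝ} {ν : Measure ℝ}

/-- `t ↦ δ t - X_t` is a Lévy process if `X` is. -/
theorem IsLevyProcess.drift_sub (hX : IsLevyProcess X P) (δ : ℝ) :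
    IsLevyProcess (fun t ω => δ * t - X t ω) P where
  measurable t := (hX.measurable t).const_sub _
  start_zero := by
    filter_upwards [hX.start_zero] with ω hω
    simp [hω]
  cadlag := by
    filter_upwards [hX.cadlag] with ω hω t
    have hc : Continuous (fun t : ℝ≥0 => δ * (t : ℝ)) := by fun_prop
    obtain ⟨h1, l, hl⟩ := hω t
    exact ⟨hc.continuousWithinAt.sub h1, _, ((hc.tendsto t).mono_left nhdsWithin_le_nhds).sub hl⟩
  indep_increments := by
    intro n t ht
    refine ((hX.indep_increments n t ht).comp
      (fun i x => δ * ((t i.succ : ℝ) - t i.castSucc) - x) (fun i => by fun_prop)).congr fun i => ?_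
    refine ae_of_all _ fun ω => ?_
    simp only [Function.comp]
    ring
  stationary s h := by
    have := (hX.stationary s h).comp (u := fun x => δ * h - x) (by fun_prop)
    have e : (fun ω => (δ * ((s + h : ℝ≥0) : ℝ) - X (s + h) ω) - (δ * s - X s ω)) =
        (fun x => δ * h - x) ∘ fun ω => X (s + h) ω - X s ω := by
      funext ω
      simp only [Function.comp, NNReal.coe_add]
      ring
    rw [e]
    exact this

/-- A random variable all of whose Laplace transforms at `0, 1, 2, …` are at most `1` is almost
surely nonnegative. -/
theorem ae_nonneg_of_lintegral_exp_le_one {Y : Ω → ℝ} (hY : Measurable Y)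
    (h : ∀ k : ℕ, ∫⁻ ω, ENNReal.ofReal (Real.exp (-(k * Y ω))) ∂P ≤ 1) : ∀ᵐ ω ∂P, 0 ≤ Y ω := by
  have hm : ∀ k : ℕ, Measurable fun ω => ENNReal.ofReal (Real.exp (-(k * Y ω))) := fun k => by
    fun_prop
  have hle : ∫⁻ ω, liminf (fun k : ℕ => ENNReal.ofReal (Real.exp (-(k * Y ω)))) atTop ∂P ≤ 1 :=
    (lintegral_liminf_le hm).trans
      (liminf_le_of_frequently_le' (Eventually.frequently (Eventually.of_forall h)))
  filter_upwards [ae_lt_top (Measurable.liminf hm) (hle.trans_lt ENNReal.one_lt_top).ne]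
    with ω hω
  by_contra hneg
  have ht : Tendsto (fun k : ℕ => ENNReal.ofReal (Real.exp (-(k * Y ω)))) atTop (𝓝 ⊤) := by
    refine ENNReal.tendsto_ofReal_atTop.comp (Real.tendsto_exp_atTop.comp ?_)
    have := (tendsto_natCast_atTop_atTop (R := ℝ)).atTop_mul_const
      (neg_pos.2 (not_le.1 hneg))
    exact this.congr fun k => by ring
  rw [ht.liminf_eq] at hω
  exact lt_irrefl _ hω

/-- A Lévy process which is almost surely nonnegative at each time has nondecreasing paths. -/
theorem IsLevyProcess.ae_monotone (hS : IsLevyProcess S P) (h : ∀ t, ∀ᵐ ω ∂P, 0 ≤ S t ω) :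
    ∀ᵐ ω ∂P, Monotone fun t => S t ω := by
  obtain ⟨D, hDc, hD⟩ := TopologicalSpace.exists_countable_dense ℝ≥0
  have hinc : ∀ a b : ℝ≥0, a ≤ b → ∀ᵐ ω ∂P, S a ω ≤ S b ω := by
    intro a b hab
    have hst := hS.stationary a (b - a)
    rw [add_tsub_cancel_of_le hab] at hst
    have := hst.symm.ae_snd (p := fun x => 0 ≤ x) measurableSet_Ici (h (b - a))
    exact this.mono fun ω hω => sub_nonneg.1 hω
  have hall : ∀ᵐ ω ∂P, ∀ a ∈ D, ∀ b ∈ D, a ≤ b → S a ω ≤ S b ω := by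
    rw [ae_ball_iff hDc]
    intro a _
    rw [ae_ball_iff hDc]
    intro b _
    by_cases hab : a ≤ b
    · exact (hinc a b hab).mono fun ω hω _ => hω
    · exact ae_of_all _ fun ω hab' => absurd hab' hab
  filter_upwards [hall, hS.cadlag] with ω h1 h2
  exact monotone_of_dense hD (fun t => (h2 t).1) h1

variable [IsProbabilityMeasure P]

/-- `E[exp (-β S_t)] = exp (-t κ(β))` for `S_t = δ t - X_t`. -/
theorem IsSpectrallyNegativeLevy.lintegral_exp_neg_sub
    (hX : IsSpectrallyNegativeLevy X P μ 0 ν)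
    (hfin : ∫⁻ x in Set.Ioo (-1 : ℝ) 0, ENNReal.ofReal |x| ∂ν ≠ ⊤) (t : ℝ≥0) {β : ℝ} (hβ : 0 ≤ β) :
    ∫⁻ ω, ENNReal.ofReal (Real.exp (-(β * (driftCoeff μ ν * t - X t ω)))) ∂P =
      ENNReal.ofReal (Real.exp (-(t * subExponent ν β))) := by
  have h1 : ∀ ω, ENNReal.ofReal (Real.exp (-(β * (driftCoeff μ ν * t - X t ω)))) =
      ENNReal.ofReal (Real.exp (-(β * (driftCoeff μ ν * t)))) *
        ENNReal.ofReal (Real.exp (β * X t ω)) := by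
    intro ω
    rw [← ENNReal.ofReal_mul (Real.exp_pos _).le, ← Real.exp_add]
    congr 2; ring
  have hm := hX.levy.measurable t
  simp_rw [h1]
  rw [lintegral_const_mul _ (by fun_prop), hX.lintegral_exp t hβ,
    ← ENNReal.ofReal_mul (Real.exp_pos _).le, ← Real.exp_add,
    hX.isLevyMeasure.lapExponent_eq hX.no_positive_jumps hfin hβ]
  congr 2; ring

theorem IsSpectrallyNegativeLevy.ae_sub_nonneg
    (hX : IsSpectrallyNegativeLevy X P μ 0 ν)
    (hfin : ∫⁻ x in Set.Ioo (-1 : ℝ) 0, ENNReal.ofReal |x| ∂ν ≠ ⊤) (t : ℝ≥0) :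
    ∀ᵐ ω ∂P, 0 ≤ driftCoeff μ ν * t - X t ω := by
  refine ae_nonneg_of_lintegral_exp_le_one ((hX.levy.measurable t).const_sub _) fun k => ?_
  rw [hX.lintegral_exp_neg_sub hfin t k.cast_nonneg, ENNReal.ofReal_le_one, Real.exp_le_one_iff]
  have := hX.isLevyMeasure.subExponent_nonneg hX.no_positive_jumps (β := k) k.cast_nonneg
  have := mul_nonneg t.coe_nonneg this
  linarith

/-- `E[(1/β) ∧ S_h] ≤ 2 h κ(β) / β` for `S_h = δ h - X_h`: summed over a grid of mesh `h` on `[0, N]`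
this is at most `2 N κ(β) / β`, whatever the mesh, and it vanishes as `β → ∞`. -/
theorem IsSpectrallyNegativeLevy.lintegral_min_le
    (hX : IsSpectrallyNegativeLevy X P μ 0 ν)
    (hfin : ∫⁻ x in Set.Ioo (-1 : ℝ) 0, ENNReal.ofReal |x| ∂ν ≠ ⊤) (h : ℝ≥0) {β : ℝ} (hβ : 0 < β) :
    ∫⁻ ω, ENNReal.ofReal (min (1 / β) (driftCoeff μ ν * h - X h ω)) ∂P ≤
      ENNReal.ofReal (h * (2 * (subExponent ν β / β))) := by
  have hm := hX.levy.measurable h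
  have hnn := hX.ae_sub_nonneg hfin h
  have hi : Integrable (fun ω => Real.exp (-(β * (driftCoeff μ ν * h - X h ω)))) P := by
    refine Integrable.of_bound (C := 1) (by fun_prop) (hnn.mono fun ω hω => ?_)
    rw [Real.norm_eq_abs, abs_of_pos (Real.exp_pos _), Real.exp_le_one_iff]
    have := mul_nonneg hβ.le hω
    linarith
  have hv : ∫ ω, Real.exp (-(β * (driftCoeff μ ν * h - X h ω))) ∂P =
      Real.exp (-(h * subExponent ν β)) := by
    rw [integral_eq_lintegral_of_nonneg_ae (ae_of_all _ fun ω => (Real.exp_pos _).le) (by fun_prop),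
      hX.lintegral_exp_neg_sub hfin h hβ.le, ENNReal.toReal_ofReal (Real.exp_pos _).le]
  have hi2 : Integrable (fun ω => 2 / β * (1 - Real.exp (-(β * (driftCoeff μ ν * h - X h ω))))) P :=
    ((integrable_const 1).sub hi).const_mul _
  calc _ ≤ ∫⁻ ω, ENNReal.ofReal
        (2 / β * (1 - Real.exp (-(β * (driftCoeff μ ν * h - X h ω))))) ∂P := by
        refine lintegral_mono_ae (hnn.mono fun ω hω => ENNReal.ofReal_le_ofReal ?_)
        have h1 := min_one_le_two_mul_one_sub_exp (mul_nonneg hβ.le hω)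
        have h2 : min (1 / β) (driftCoeff μ ν * h - X h ω) =
            1 / β * min 1 (β * (driftCoeff μ ν * h - X h ω)) := by
          rw [mul_min_of_nonneg _ _ (by positivity)]
          congr 1
          · ring
          · field_simp
        rw [h2]
        calc _ ≤ 1 / β * (2 * (1 - Real.exp (-(β * (driftCoeff μ ν * h - X h ω))))) := by
              gcongr
          _ = _ := by ring
    _ = ENNReal.ofReal (2 / β * (1 - Real.exp (-(h * subExponent ν β)))) := by
        rw [← ofReal_integral_eq_lintegral_ofReal hi2, integral_const_mul,
          integral_sub (integrable_const 1) hi, hv]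
        · simp
        · refine hnn.mono fun ω hω => mul_nonneg (by positivity) (sub_nonneg.2 ?_)
          rw [Real.exp_le_one_iff]
          have := mul_nonneg hβ.le hω
          linarith
    _ ≤ _ := by
        refine ENNReal.ofReal_le_ofReal ?_
        have h1 := Real.add_one_le_exp (-(h * subExponent ν β))
        calc 2 / β * (1 - Real.exp (-(h * subExponent ν β))) ≤ 2 / β * (h * subExponent ν β) := by
              gcongr; linarith
          _ = _ := by ring

/-- With `S_t = δ t - X_t`, almost surely the sums over fine grids of `[0, N]` of the increments of
`S` truncated at `1 / (k + 1)` become arbitrarily small, in the lower limit, for suitable `k`. -/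
theorem IsSpectrallyNegativeLevy.ae_iInf_liminf_eq_zero
    (hX : IsSpectrallyNegativeLevy X P μ 0 ν)
    (hfin : ∫⁻ x in Set.Ioo (-1 : ℝ) 0, ENNReal.ofReal |x| ∂ν ≠ ⊤) (N : ℕ) :
    ∀ᵐ ω ∂P, ⨅ k : ℕ, liminf (fun n : ℕ => ∑ i ∈ Finset.range (n + 1), ENNReal.ofReal
      (min (1 / ((k : ℝ) + 1))
        ((driftCoeff μ ν * ((((i + 1 : ℕ) : ℝ≥0) * ((N : ℝ≥0) / (n + 1)) : ℝ≥0) : ℝ) -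
            X ((i + 1 : ℕ) * ((N : ℝ≥0) / (n + 1))) ω) -
          (driftCoeff μ ν * (((i : ℝ≥0) * ((N : ℝ≥0) / (n + 1)) : ℝ≥0) : ℝ) -
            X (i * ((N : ℝ≥0) / (n + 1))) ω)))) atTop = 0 := by
  set δ := driftCoeff μ ν with hδ
  set S : ℝ≥0 → Ω → ℝ := fun t ω => δ * t - X t ω with hS
  have hSL : IsLevyProcess S P := hX.levy.drift_sub δ
  set R : ℕ → ℕ → Ω → ℝ≥0∞ := fun k n ω => ∑ i ∈ Finset.range (n + 1), ENNReal.ofReal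
      (min (1 / ((k : ℝ) + 1)) (S ((i + 1 : ℕ) * ((N : ℝ≥0) / (n + 1))) ω -
        S (i * ((N : ℝ≥0) / (n + 1))) ω)) with hR
  have hRm : ∀ k n, Measurable (R k n) := by
    intro k n
    refine Finset.measurable_sum _ fun i _ => ?_
    have h1 := hSL.measurable ((i + 1 : ℕ) * ((N : ℝ≥0) / (n + 1)))
    have h2 := hSL.measurable (i * ((N : ℝ≥0) / (n + 1)))
    fun_prop
  have hRint : ∀ k n, ∫⁻ ω, R k n ω ∂P ≤
      ENNReal.ofReal (N * (2 * (subExponent ν ((k : ℝ) + 1) / ((k : ℝ) + 1)))) := by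
    intro k n
    have hk : (0 : ℝ) < k + 1 := by positivity
    simp only [hR]
    rw [lintegral_finsetSum _ fun i _ => by
      have h1 := hSL.measurable ((i + 1 : ℕ) * ((N : ℝ≥0) / (n + 1)))
      have h2 := hSL.measurable (i * ((N : ℝ≥0) / (n + 1)))
      fun_prop]
    have hi : ∀ i ∈ Finset.range (n + 1), ∫⁻ ω, ENNReal.ofReal (min (1 / ((k : ℝ) + 1))
        (S ((i + 1 : ℕ) * ((N : ℝ≥0) / (n + 1))) ω - S (i * ((N : ℝ≥0) / (n + 1))) ω)) ∂P ≤
        ENNReal.ofReal ((((N : ℝ≥0) / (n + 1) : ℝ≥0) : ℝ) *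
          (2 * (subExponent ν ((k : ℝ) + 1) / ((k : ℝ) + 1)))) := by
      intro i _
      rw [hSL.lintegral_increment ((N : ℝ≥0) / (n + 1))
        (f := fun x => ENNReal.ofReal (min (1 / ((k : ℝ) + 1)) x)) (by fun_prop) i]
      exact hX.lintegral_min_le hfin _ hk
    refine (Finset.sum_le_sum hi).trans (le_of_eq ?_)
    rw [Finset.sum_const, Finset.card_range, nsmul_eq_mul, ← ENNReal.ofReal_natCast,
      ← ENNReal.ofReal_mul (by positivity)]
    congr 1
    push_cast
    field_simp
  set F : ℕ → Ω → ℝ≥0∞ := fun k ω => liminf (fun n => R k n ω) atTop with hF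
  have hFm : ∀ k, Measurable (F k) := fun k => Measurable.liminf (hRm k)
  have hFint : ∀ k, ∫⁻ ω, F k ω ∂P ≤
      ENNReal.ofReal (N * (2 * (subExponent ν ((k : ℝ) + 1) / ((k : ℝ) + 1)))) := fun k =>
    (lintegral_liminf_le (hRm k)).trans (liminf_le_of_frequently_le'
      (Eventually.frequently (Eventually.of_forall (hRint k))))
  have hlim : Tendsto (fun k : ℕ => ENNReal.ofReal
      (N * (2 * (subExponent ν ((k : ℝ) + 1) / ((k : ℝ) + 1))))) atTop (𝓝 0) := by
    have h1 := (hX.isLevyMeasure.tendsto_subExponent_div hX.no_positive_jumps hfin).comp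
      (tendsto_atTop_add_const_right atTop (1 : ℝ) (tendsto_natCast_atTop_atTop (R := ℝ)))
    have h2 := ENNReal.tendsto_ofReal ((h1.const_mul 2).const_mul (N : ℝ))
    simpa using h2
  have hzero : ∫⁻ ω, ⨅ k, F k ω ∂P = 0 := by
    refine le_antisymm (ge_of_tendsto hlim (Eventually.of_forall fun k => ?_)) bot_le
    exact (lintegral_mono fun ω => iInf_le _ k).trans (hFint k)
  exact (lintegral_eq_zero_iff (Measurable.iInf hFm)).1 hzero

/-- The diffuse part of the Stieltjes measure of a path is bounded by the grid sums of truncated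
increments, hence vanishes. -/
theorem IsSpectrallyNegativeLevy.isPureJumpSubordinator
    (hX : IsSpectrallyNegativeLevy X P μ 0 ν)
    (hfin : ∫⁻ x in Set.Ioo (-1 : ℝ) 0, ENNReal.ofReal |x| ∂ν ≠ ⊤) :
    IsPureJumpSubordinator (fun t ω => driftCoeff μ ν * t - X t ω) P := by
  have hSL := hX.levy.drift_sub (driftCoeff μ ν)
  have hmono := hSL.ae_monotone (hX.ae_sub_nonneg hfin)
  refine ⟨hSL, hmono, ?_⟩
  filter_upwards [hmono, hSL.cadlag, hSL.start_zero,
    ae_all_iff.2 fun N => hX.ae_iInf_liminf_eq_zero hfin N] with ω h1 h2 h3 h4 t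
  let f : StieltjesFunction ℝ≥0 := ⟨fun t => driftCoeff μ ν * t - X t ω, h1, fun t => (h2 t).1⟩
  refine StieltjesFunction.hasSum_jumps f h3 (fun N => le_antisymm ?_ bot_le) t
  refine le_trans (le_iInf fun k => ?_) (h4 N).le
  exact f.measure_diff_atoms_le N (by positivity)

theorem IsSpectrallyNegativeLevy.hasDriftDecomposition
    (hX : IsSpectrallyNegativeLevy X P μ 0 ν)
    (hfin : ∫⁻ x in Set.Ioo (-1 : ℝ) 0, ENNReal.ofReal |x| ∂ν ≠ ⊤) :
    HasDriftDecomposition X P (driftCoeff μ ν) :=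
  ⟨_, hX.isPureJumpSubordinator hfin, ae_of_all _ fun ω t => by ring⟩

theorem IsSpectrallyNegativeLevy.boundedVariation
    (hX : IsSpectrallyNegativeLevy X P μ 0 ν)
    (hfin : ∫⁻ x in Set.Ioo (-1 : ℝ) 0, ENNReal.ofReal |x| ∂ν ≠ ⊤) : HasPathsOfBoundedVariation X P := by
  filter_upwards [(hX.isPureJumpSubordinator hfin).monotone] with ω hω
  have hd : LocallyBoundedVariationOn (fun t : ℝ≥0 => driftCoeff μ ν * (t : ℝ)) Set.univ := by
    rcases le_total 0 (driftCoeff μ ν) with h | h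
    · refine MonotoneOn.locallyBoundedVariationOn fun a _ b _ hab => ?_
      have : (a : ℝ) ≤ b := hab
      exact mul_le_mul_of_nonneg_left this h
    · have h2 : LocallyBoundedVariationOn
          (fun t : ℝ≥0 => (0 : ℝ) - -driftCoeff μ ν * (t : ℝ)) Set.univ := by
        refine locallyBoundedVariationOn_sub
          (MonotoneOn.locallyBoundedVariationOn fun a _ b _ _ => le_rfl)
          (MonotoneOn.locallyBoundedVariationOn fun a _ b _ hab => ?_)
        have : (a : ℝ) ≤ b := hab
        exact mul_le_mul_of_nonneg_left this (neg_nonneg.2 h)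
      simpa using h2
  have := locallyBoundedVariationOn_sub hd (hω.monotoneOn Set.univ).locallyBoundedVariationOn
  simpa using this

/-- Otherwise `X_t = δ t - S_t` would have nonincreasing paths. -/
theorem IsSpectrallyNegativeLevy.driftCoeff_pos
    (hX : IsSpectrallyNegativeLevy X P μ 0 ν)
    (hfin : ∫⁻ x in Set.Ioo (-1 : ℝ) 0, ENNReal.ofReal |x| ∂ν ≠ ⊤) : 0 < driftCoeff μ ν := by
  by_contra h
  refine hX.not_nonincreasing ?_
  filter_upwards [(hX.isPureJumpSubordinator hfin).monotone] with ω hω a b hab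
  have h1 := hω hab
  have h2 : (a : ℝ) ≤ b := hab
  have h3 := mul_le_mul_of_nonpos_left h2 (not_lt.1 h)
  simp only at h1 ⊢
  linarith

end Drift

/-! ### Uniqueness of the drift and conclusion -/

theorem leftLim_add_mul {f : ℝ≥0 → ℝ} (hf : Monotone f) (c : ℝ) (s : ℝ≥0) :
    Function.leftLim (fun t : ℝ≥0 => f t + c * t) s = Function.leftLim f s + c * s := by
  rcases eq_or_neBot (𝓝[<] s) with h | h
  · rw [leftLim_eq_of_eq_bot _ h, leftLim_eq_of_eq_bot _ h]
  · have hc : Continuous (fun t : ℝ≥0 => c * (t : ℝ)) := by fun_prop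
    exact leftLim_eq_of_tendsto
      ((hf.tendsto_leftLim s).add ((hc.tendsto s).mono_left nhdsWithin_le_nhds))

/-- The drift is determined by the process: adding a linear function to a path leaves its jumps
unchanged, while a pure jump path is the sum of its jumps. -/
theorem HasDriftDecomposition.unique {Ω : Type*} [MeasurableSpace Ω] {P : Measure Ω}
    [IsProbabilityMeasure P] {X : ℝ≥0 → Ω → ℝ} {δ δ' : ℝ} (h : HasDriftDecomposition X P δ)
    (h' : HasDriftDecomposition X P δ') : δ' = δ := by
  obtain ⟨S, hS, hXS⟩ := h
  obtain ⟨S', hS', hXS'⟩ := h'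
  obtain ⟨ω, h1, h2, h3, h4, h5⟩ :=
    (hXS.and (hXS'.and (hS.monotone.and (hS.pure_jump.and hS'.pure_jump)))).exists
  have he : (fun t => S' t ω) = fun t : ℝ≥0 => S t ω + (δ' - δ) * t := by
    funext t
    have := h1 t
    have := h2 t
    linarith
  have hj : ∀ s : ℝ≥0, S' s ω - Function.leftLim (fun u => S' u ω) s =
      S s ω - Function.leftLim (fun u => S u ω) s := by
    intro s
    rw [he, leftLim_add_mul h3, congrFun he s]
    ring
  have h6 := h5 1
  simp_rw [hj] at h6
  have h7 := h6.unique (h4 1)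
  have h8 := congrFun he 1
  simp only [NNReal.coe_one, mul_one] at h8
  linarith

namespace IsSpectrallyNegativeLevy

variable {Ω : Type*} [MeasurableSpace Ω] {P : Measure Ω} [IsProbabilityMeasure P]
  {X : ℝ≥0 → Ω → ℝ} {μ σ q : ℝ} {ν : Measure ℝ} {W : ℝ → ℝ}

theorem eventuallyEq_laplaceExponent_div (hX : IsSpectrallyNegativeLevy X P μ σ ν) :
    (fun β => lapExponent μ σ ν β / β) =ᶠ[atTop] fun β => laplaceExponent X P β / β := by
  filter_upwards [eventually_ge_atTop 0] with β hβ
  rw [hX.laplaceExponent_eq hβ]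

theorem scale_of_boundedVariation (hX : IsSpectrallyNegativeLevy X P μ 0 ν)
    (hfin : ∫⁻ x in Set.Ioo (-1 : ℝ) 0, ENNReal.ofReal |x| ∂ν ≠ ⊤)
    (hW : IsScaleFunction (laplaceExponent X P) q W) :
    W 0 = 1 / driftCoeff μ ν ∧
      Tendsto (fun β : ℝ => β / laplaceExponent X P β) atTop (𝓝 (W 0)) := by
  have hδ := (hX.driftCoeff_pos hfin).ne'
  have h1 := (hX.isLevyMeasure.tendsto_lapExponent_div hX.no_positive_jumps hfin
    (μ := μ)).congr' hX.eventuallyEq_laplaceExponent_div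
  have h2 : Tendsto (fun β => (laplaceExponent X P β - q) / β) atTop (𝓝 (driftCoeff μ ν)) := by
    have hq : Tendsto (fun β : ℝ => q / β) atTop (𝓝 0) := tendsto_const_nhds.div_atTop tendsto_id
    have := h1.sub hq
    rw [sub_zero] at this
    exact this.congr fun β => (sub_div _ _ _).symm
  have hW0 : W 0 = 1 / driftCoeff μ ν := by
    refine tendsto_nhds_unique hW.tendsto_zero ?_
    rw [one_div]
    exact (h2.inv₀ hδ).congr fun β => inv_div _ _
  refine ⟨hW0, ?_⟩
  rw [hW0, one_div]
  exact (h1.inv₀ hδ).congr fun β => inv_div _ _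

theorem scale_of_unboundedVariation (hX : IsSpectrallyNegativeLevy X P μ σ ν)
    (h : σ ≠ 0 ∨ ∫⁻ x in Set.Ioo (-1 : ℝ) 0, ENNReal.ofReal |x| ∂ν = ⊤)
    (hW : IsScaleFunction (laplaceExponent X P) q W) :
    W 0 = 0 ∧ Tendsto (fun β : ℝ => β / laplaceExponent X P β) atTop (𝓝 (W 0)) := by
  have h1 := (hX.isLevyMeasure.tendsto_lapExponent_div_atTop hX.no_positive_jumps h
    (μ := μ)).congr' hX.eventuallyEq_laplaceExponent_div
  have h2 : Tendsto (fun β => (laplaceExponent X P β - q) / β) atTop atTop := by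
    have hq : Tendsto (fun β : ℝ => -(q / β)) atTop (𝓝 (-0)) :=
      (tendsto_const_nhds.div_atTop tendsto_id).neg
    exact (h1.atTop_add hq).congr fun β => by ring
  have hW0 : W 0 = 0 :=
    tendsto_nhds_unique hW.tendsto_zero
      ((tendsto_inv_atTop_zero.comp h2).congr fun β => inv_div _ _)
  refine ⟨hW0, ?_⟩
  rw [hW0]
  exact (tendsto_inv_atTop_zero.comp h1).congr fun β => inv_div _ _

theorem not_boundedVariation_iff (hX : IsSpectrallyNegativeLevy X P μ σ ν) :
    ¬ HasPathsOfBoundedVariation X P ↔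
      σ ≠ 0 ∨ ∫⁻ x in Set.Ioo (-1 : ℝ) 0, ENNReal.ofReal |x| ∂ν = ⊤ := by
  constructor
  · intro h
    by_contra hc
    push Not at hc
    obtain ⟨rfl, hfin⟩ := hc
    exact h (hX.boundedVariation hfin)
  · intro h hbv
    obtain ⟨h1, h2⟩ := hX.of_boundedVariation hbv
    exact h.elim (fun h => h h1) h2

end IsSpectrallyNegativeLevy

theorem lemmaW {Ω : Type*} [MeasurableSpace Ω] (P : Measure Ω) [IsProbabilityMeasure P]
    (X : ℝ≥0 → Ω → ℝ) (μ σ : ℝ) (ν : Measure ℝ) (hX : IsSpectrallyNegativeLevy X P μ σ ν)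
    (q : ℝ) (hq : 0 ≤ q) (W : ℝ → ℝ) (hW : IsScaleFunction (laplaceExponent X P) q W) :
    (W 0 = 0 ↔ ¬ HasPathsOfBoundedVariation X P) ∧
    (¬ HasPathsOfBoundedVariation X P ↔
      σ ≠ 0 ∨ ∫⁻ x in Set.Ioo (-1 : ℝ) 0, ENNReal.ofReal |x| ∂ν = ⊤) ∧
    (HasPathsOfBoundedVariation X P →
      ∃ δ : ℝ, 0 < δ ∧ HasDriftDecomposition X P δ ∧
        (∀ δ' : ℝ, HasDriftDecomposition X P δ' → δ' = δ) ∧ W 0 = 1 / δ) ∧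
    Tendsto (fun β : ℝ => β / laplaceExponent X P β) atTop (𝓝 (W 0)) := by
  by_cases hbv : HasPathsOfBoundedVariation X P
  · obtain ⟨rfl, hfin⟩ := hX.of_boundedVariation hbv
    obtain ⟨hW0, hlim⟩ := hX.scale_of_boundedVariation hfin hW
    have hδ := hX.driftCoeff_pos hfin
    have hdec := hX.hasDriftDecomposition hfin
    have hne : W 0 ≠ 0 := by rw [hW0]; positivity
    exact ⟨iff_of_false hne (not_not.2 hbv), hX.not_boundedVariation_iff,
      fun _ => ⟨_, hδ, hdec, fun _ h => hdec.unique h, hW0⟩, hlim⟩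
  · obtain ⟨hW0, hlim⟩ := hX.scale_of_unboundedVariation (hX.not_boundedVariation_iff.1 hbv) hW
    exact ⟨iff_of_true hW0 hbv, hX.not_boundedVariation_iff, fun h => absurd h hbv, hlim⟩
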